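/- Let $M$ be a closed (compact, without boundary) connected smooth Riemannian manifold of dimension $n$ with Riemannian volume $\mu$. Let $\mathrm{Diff}(M)$ be its group of smooth diffeomorphisms, with Lie algebra $T_e\mathrm{Diff}(M)$ the smooth vector fields on $M$ and $\mathrm{ad}_uv=-[u,v]$. Define $\mathrm{Jac}_\mu(\eta)>0$ by $\eta^*\mu=\mathrm{Jac}_\mu(\eta)\,\mu$ (as densities), let $\mathrm{Diff}_\mu(M)=\{\eta:\mathrm{Jac}_\mu(\eta)=1\}$, whose Lie algebra $T_e\mathrm{Diff}_\mu(M)$ consists of the smooth divergence-free fields, and let $$\mathrm{Dens}(M)=\Big\{R\in C^\infty(M):\ R>0,\ \int_M R\,d\mu=\mu(M)\Big\}$$ with tangent spaces $\{f\in C^\infty(M):\int_M f\,d\mu=0\}$. For $a,b,c\ge 0$ the $a$-$b$-$c$ metric is the right-invariant metric $\langle\langle u\circ\eta,v\circ\eta\rangle\rangle_\eta=\langle\langle u,v\rangle\rangle$ on $\mathrm{Diff}(M)$ given by $$\langle\langle u,v\rangle\rangle=a\int_M\langle u,v\rangle\,d\mu+b\int_M\langle\delta u^\flat,\delta v^\flat\rangle\,d\mu+c\int_M\langle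 du^\flat,dv^\flat\rangle\,d\mu .$$ Let $a=c=0$ and $b>0$. Then: (i) (Bi-invariance.) For all $u,v$ in the orthogonal complement of $T_e\mathrm{Diff}_\mu(M)$ and all $w\in T_e\mathrm{Diff}_\mu(M)$, $$\langle\langle v,\mathrm{ad}_wu\rangle\rangle+\langle\langle u,\mathrm{ad}_wv\rangle\rangle=0 .$$ Moreover, a smooth field $u$ satisfies $\langle\langle u,v\rangle\rangle=0$ for all smooth fields $v$ if and only if $\operatorname{div}u=0$; thus the orthogonal complement is all of $T_e\mathrm{Diff}(M)$, and the metric degenerates exactly along $T_e\mathrm{Diff}_\mu(M)$. (ii) (Descent.) The metric descends to $\mathrm{Dens}(M)$ along the projection $\pi(\eta)=\mathrm{Jac}_\mu(\eta)$, which takes values in $\mathrm{Dens}(M)$ and whose fibres are the cosets $\mathrm{Diff}_\mu(M)\,\eta$: there is a smooth, nondegenerate (weak) Riemannian metric $G$ on $\mathrm{Dens}(M)$, invariant under the right action $(R,\xi)\mapsto (R\circ\xi)\,\mathrm{Jac}_\mu(\xi)$ of $\mathrm{Diff}(M)$, such that $$G_{\pi(\eta)}\big(d\pi_\eta(u\circ\eta),d\pi_\eta(v\circ\eta)\big)=\langle\langle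 u,v\rangle\rangle$$ for all $\eta\in\mathrm{Diff}(M)$ and all smooth vector fields $u,v$. (iii) (Euler–Arnold equation.) Let $B(u,v)\in T_e\mathrm{Diff}(M)/T_e\mathrm{Diff}_\mu(M)$ be defined by $\langle\langle B(u,v),w\rangle\rangle=\langle\langle u,\mathrm{ad}_vw\rangle\rangle$ for all $w$. A smooth time-dependent vector field $u(t)$, with $t$ in an open subset of $\mathbb R$, satisfies the Euler–Arnold equation $u_t=-B(u,u)$ of the quotient (an equality modulo $T_e\mathrm{Diff}_\mu(M)$) if and only if $$d\operatorname{div}u_t+\operatorname{div}u\;d\operatorname{div}u+d\,\iota_u(d\operatorname{div}u)=0,$$ and if and only if $\rho=\operatorname{div}u$ satisfies $$\rho_t+\langle u,\nabla\rho\rangle+\tfrac12\rho^2=-\frac{\int_M\rho^2\,d\mu}{2\mu(M)} .$$ -/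

import Mathlib

open MeasureTheory Set
open scoped Manifold ContDiff Topology

noncomputable section

namespace HunterSaxton

/-- The model space `ℝⁿ`. -/
abbrev Model (n : ℕ) : Type := EuclideanSpace ℝ (Fin n)

/-- The standard basis of `ℝⁿ`. -/
def stdVec {n : ℕ} (i : Fin n) : Model n := EuclideanSpace.single i 1

section Geometry

variable {n : ℕ} {M : Type*} [TopologicalSpace M] [ChartedSpace (Model n) M]

/-- The tangent vector of `M` at the point `φ_c⁻¹(y)` given by the `i`-th coordinate vector field
of the chart `φ_c = chartAt c`. -/
def coordVec (c : M) (y : Model n) (i : Fin n) :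
    TangentSpace (𝓡 n) ((chartAt (Model n) c).symm y) :=
  mfderiv (𝓡 n) (𝓡 n) (chartAt (Model n) c).symm y (stdVec i : Model n)

/-- The `i`-th component, at `y`, of the vector field `u` in the chart `φ_c = chartAt c`. -/
def comp (u : Π x : M, TangentSpace (𝓡 n) x) (c : M) (y : Model n) (i : Fin n) : ℝ :=
  let v : Model n := mfderiv (𝓡 n) (𝓡 n) (chartAt (Model n) c) ((chartAt (Model n) c).symm y)
    (u ((chartAt (Model n) c).symm y))
  v i

/-- The `i`-th component, at `y`, of the one-form `α` in the chart `φ_c = chartAt c`. -/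
def formComp (α : Π x : M, TangentSpace (𝓡 n) x →L[ℝ] ℝ) (c : M) (y : Model n) (i : Fin n) : ℝ :=
  α ((chartAt (Model n) c).symm y) (coordVec c y i)

/-- `∂ᵢ F` at `y`. -/
def partialD (i : Fin n) (F : Model n → ℝ) (y : Model n) : ℝ := fderiv ℝ F y (stdVec i)

/-- The differential of a real function on `M`, as a one-form. -/
def dFun (f : M → ℝ) (x : M) : TangentSpace (𝓡 n) x →L[ℝ] ℝ :=
  mfderiv (𝓡 n) 𝓘(ℝ, ℝ) f x

/-- The exterior derivative of a one-form `α` at `x`: the components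
`∂ᵢ αⱼ - ∂ⱼ αᵢ` in the chart at `x`. -/
def extD (α : Π x : M, TangentSpace (𝓡 n) x →L[ℝ] ℝ) (x : M) (i j : Fin n) : ℝ :=
  partialD i (fun y => formComp α x y j) (chartAt (Model n) x x)
    - partialD j (fun y => formComp α x y i) (chartAt (Model n) x x)

variable [IsManifold (𝓡 n) ∞ M]

variable (n M) in
/-- Smooth Riemannian metrics on `M`. -/
abbrev RMetric : Type _ :=
  Bundle.ContMDiffRiemannianMetric (𝓡 n) ∞ (Model n) (fun x : M => TangentSpace (𝓡 n) x)

/-- Smooth vector fields. -/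
def SmoothField (u : Π x : M, TangentSpace (𝓡 n) x) : Prop :=
  ContMDiff (𝓡 n) (𝓡 n).tangent ∞ (fun x => (⟨x, u x⟩ : TangentBundle (𝓡 n) M))

/-- The matrix `g_{ij}(y)` of the metric in the chart `chartAt c`. -/
def gram (g : RMetric n M) (c : M) (y : Model n) : Matrix (Fin n) (Fin n) ℝ :=
  Matrix.of fun i j => g.inner ((chartAt (Model n) c).symm y) (coordVec c y i) (coordVec c y j)

/-- The density `√det(g_{ij})` of the Riemannian volume in the chart `chartAt c`. -/
def sqrtDet (g : RMetric n M) (c : M) (y : Model n) : ℝ := √(gram g c y).det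

/-- The divergence of a vector field: `div u = (1/√det g) ∑ ∂ᵢ(√det g uⁱ)`
in the chart at `x`. -/
def divg (g : RMetric n M) (u : Π x : M, TangentSpace (𝓡 n) x) (x : M) : ℝ :=
  (sqrtDet g x (chartAt (Model n) x x))⁻¹ *
    ∑ i, partialD i (fun y => sqrtDet g x y * comp u x y i) (chartAt (Model n) x x)

/-- The one-form `u♭ = g(u, ·)`. -/
def flat (g : RMetric n M) (u : Π x : M, TangentSpace (𝓡 n) x) (x : M) :
    TangentSpace (𝓡 n) x →L[ℝ] ℝ := g.inner x (u x)

/-- The codifferential of a one-form: `δα = -(1/√det g) ∑ ∂ᵢ(√det g g^{ij} αⱼ)`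
in the chart at `x`. -/
def codiff (g : RMetric n M) (α : Π x : M, TangentSpace (𝓡 n) x →L[ℝ] ℝ) (x : M) : ℝ :=
  -((sqrtDet g x (chartAt (Model n) x x))⁻¹ *
    ∑ i, partialD i
      (fun y => sqrtDet g x y * ∑ j, (gram g x y)⁻¹ i j * formComp α x y j)
      (chartAt (Model n) x x))

/-- The inner product at `x` of two-forms given by their (antisymmetric) components in the chart at
`x`: `⟨β, γ⟩ = ½ ∑ g^{ik} g^{jl} β_{ij} γ_{kl}`. -/
def twoFormInner (g : RMetric n M) (x : M) (β γ : Fin n → Fin n → ℝ) : ℝ :=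
  (1 / 2) * ∑ i, ∑ j, ∑ k, ∑ l,
    (gram g x (chartAt (Model n) x x))⁻¹ i k * (gram g x (chartAt (Model n) x x))⁻¹ j l
      * β i j * γ k l

/-- The Riemannian volume density evaluated on `n` tangent vectors: `√det(g(vᵢ, vⱼ))`. -/
def volDensity (g : RMetric n M) (x : M) (v : Fin n → TangentSpace (𝓡 n) x) : ℝ :=
  √(Matrix.of fun i j => g.inner x (v i) (v j)).det

/-- The Jacobian `Jac_μ(η)`, i.e. `η^*μ = Jac_μ(η) μ` for the Riemannian volume density `μ`
(evaluated on an arbitrary basis of the tangent space). -/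
def jac (g : RMetric n M) (η : M ≃ₘ^∞⟮𝓡 n, 𝓡 n⟯ M) (x : M) : ℝ :=
  volDensity g (η x) (fun i => mfderiv (𝓡 n) (𝓡 n) η x (stdVec i : Model n)) /
    volDensity g x (fun i => (stdVec i : Model n))

variable [CompactSpace M] [T2Space M] [MeasurableSpace M] [BorelSpace M]

variable (n M) in
/-- A smooth partition of unity subordinate to the atlas of preferred charts. -/
def chartPartition : SmoothPartitionOfUnity M (𝓡 n) M univ :=
  Classical.choose (SmoothPartitionOfUnity.exists_isSubordinate_chartAt_source (𝓡 n) M)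

/-- The Riemannian volume measure `μ`: the sum over `c` of the measures
`χ_c √det g dy¹ ⋯ dyⁿ` on the chart domains, `χ_c` being a partition of unity. -/
def vol (g : RMetric n M) : Measure M :=
  Measure.sum fun c : M =>
    (((volume : Measure (Model n)).restrict (chartAt (Model n) c).target).withDensity
      (fun y => ENNReal.ofReal
        (chartPartition n M c ((chartAt (Model n) c).symm y) * sqrtDet g c y))).map
      (chartAt (Model n) c).symm

/-- The `a`-`b`-`c` Sobolev `H¹` product
`a ∫ ⟨u, v⟩ dμ + b ∫ ⟨δu♭, δv♭⟩ dμ + c ∫ ⟨du♭, dv♭⟩ dμ` on vector fields. -/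
def abc (g : RMetric n M) (a b c : ℝ) (u v : Π x : M, TangentSpace (𝓡 n) x) : ℝ :=
  a * ∫ x, g.inner x (u x) (v x) ∂(vol g)
    + b * ∫ x, codiff g (flat g u) x * codiff g (flat g v) x ∂(vol g)
    + c * ∫ x, twoFormInner g x (extD (flat g u) x) (extD (flat g v) x) ∂(vol g)

/-- The algebra adjoint of the diffeomorphism group: `ad_u v = -[u, v]`. -/
def adj (u v : Π x : M, TangentSpace (𝓡 n) x) : Π x : M, TangentSpace (𝓡 n) x :=
  fun x => -VectorField.mlieBracket (𝓡 n) u v x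

/-- The Lie algebra `T_e Diff_μ(M)`: smooth divergence-free vector fields. -/
def DivFree (g : RMetric n M) (w : Π x : M, TangentSpace (𝓡 n) x) : Prop :=
  SmoothField w ∧ ∀ x, divg g w x = 0

/-- The orthogonal complement of `T_e Diff_μ(M)` in `T_e Diff(M)`. -/
def Horizontal (g : RMetric n M) (a b c : ℝ) (u : Π x : M, TangentSpace (𝓡 n) x) : Prop :=
  SmoothField u ∧ ∀ w, DivFree g w → abc g a b c u w = 0

/-- The bi-invariance condition with respect to `Diff_μ(M)`. -/
def BiInvariant (g : RMetric n M) (a b c : ℝ) : Prop :=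
  ∀ u v w, Horizontal g a b c u → Horizontal g a b c v → DivFree g w →
    abc g a b c v (adj w u) + abc g a b c u (adj w v) = 0

/-! ### The space of densities -/

/-- `Dens(M)`: smooth positive densities (with respect to `μ`) of total mass `μ(M)`. -/
def IsDens (g : RMetric n M) (R : M → ℝ) : Prop :=
  ContMDiff (𝓡 n) 𝓘(ℝ, ℝ) ∞ R ∧ (∀ x, 0 < R x) ∧ ∫ x, R x ∂(vol g) = (vol g).real univ

/-- The tangent space of `Dens(M)` (the same at each point): smooth functions of zero mean. -/
def IsTangentDens (g : RMetric n M) (f : M → ℝ) : Prop :=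
  ContMDiff (𝓡 n) 𝓘(ℝ, ℝ) ∞ f ∧ ∫ x, f x ∂(vol g) = 0

/-- Smooth curves of smooth functions on `M`. -/
def SmoothFunCurve (F : ℝ → M → ℝ) : Prop :=
  ContMDiff (𝓘(ℝ, ℝ).prod (𝓡 n)) 𝓘(ℝ, ℝ) ∞ (fun p : ℝ × M => F p.1 p.2)

/-- Smooth curves in `Diff(M)`. -/
def SmoothDiffCurve (η : ℝ → M ≃ₘ^∞⟮𝓡 n, 𝓡 n⟯ M) : Prop :=
  ContMDiff (𝓘(ℝ, ℝ).prod (𝓡 n)) (𝓡 n) ∞ (fun p : ℝ × M => η p.1 p.2)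

/-- The curve `η` in `Diff(M)` has the velocity `u ∘ η₀` at time `0`. -/
def HasVelocity (η : ℝ → M ≃ₘ^∞⟮𝓡 n, 𝓡 n⟯ M) (u : Π x : M, TangentSpace (𝓡 n) x) : Prop :=
  ∀ x, mfderiv 𝓘(ℝ, ℝ) (𝓡 n) (fun s => η s x) 0 (1 : ℝ) = u (η 0 x)

/-- A (weak) Riemannian metric on `Dens(M)`: symmetric positive definite bilinear forms `G_R` on the
tangent spaces, depending smoothly on the base point (smoothness is tested along smooth curves). -/
structure IsWeakRiemannianMetric (g : RMetric n M)
    (G : (M → ℝ) → (M → ℝ) → (M → ℝ) → ℝ) : Prop where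
  symm : ∀ R f h, IsDens g R → IsTangentDens g f → IsTangentDens g h → G R f h = G R h f
  add_left : ∀ R f₁ f₂ h, IsDens g R → IsTangentDens g f₁ → IsTangentDens g f₂ →
    IsTangentDens g h → G R (f₁ + f₂) h = G R f₁ h + G R f₂ h
  smul_left : ∀ R (r : ℝ) f h, IsDens g R → IsTangentDens g f → IsTangentDens g h →
    G R (r • f) h = r * G R f h
  pos : ∀ R f, IsDens g R → IsTangentDens g f → f ≠ 0 → 0 < G R f f
  smooth : ∀ R f h : ℝ → M → ℝ, SmoothFunCurve (n := n) R → SmoothFunCurve (n := n) f →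
    SmoothFunCurve (n := n) h → (∀ s, IsDens g (R s)) → (∀ s, IsTangentDens g (f s)) →
    (∀ s, IsTangentDens g (h s)) → ContDiff ℝ ∞ (fun s => G (R s) (f s) (h s))

/-- The right-invariant metric on `Diff(M)` with `⟨⟨u ∘ η, v ∘ η⟩⟩_η = ⟨⟨u, v⟩⟩` (the
`a`-`b`-`c` product) descends to the metric `G` on `Dens(M)`, the space of cosets `Diff_μ(M) η`,
along the projection `π(η) = Jac_μ(η)`. -/
structure DescendsTo (g : RMetric n M) (a b c : ℝ)
    (G : (M → ℝ) → (M → ℝ) → (M → ℝ) → ℝ) : Prop where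
  /-- `G` is a nondegenerate weak Riemannian metric. -/
  metric : IsWeakRiemannianMetric g G
  /-- `G` is invariant under the right action of `Diff(M)` on densities by pull-back. -/
  invariant : ∀ (ξ : M ≃ₘ^∞⟮𝓡 n, 𝓡 n⟯ M) (R f h : M → ℝ), IsDens g R → IsTangentDens g f →
    IsTangentDens g h →
    G (fun x => R (ξ x) * jac g ξ x) (fun x => f (ξ x) * jac g ξ x)
      (fun x => h (ξ x) * jac g ξ x) = G R f h
  /-- `π` takes its values in `Dens(M)`. -/
  mapsTo : ∀ η : M ≃ₘ^∞⟮𝓡 n, 𝓡 n⟯ M, IsDens g (jac g η)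
  /-- The fibres of `π` are the cosets of `Diff_μ(M)`. -/
  fibre : ∀ η ξ : M ≃ₘ^∞⟮𝓡 n, 𝓡 n⟯ M, jac g η = jac g ξ ↔
    ∃ h : M ≃ₘ^∞⟮𝓡 n, 𝓡 n⟯ M, jac g h = 1 ∧ ξ = η.trans h
  /-- `dπ` preserves the inner products of horizontal vectors. -/
  submersion : ∀ (η ξ : ℝ → M ≃ₘ^∞⟮𝓡 n, 𝓡 n⟯ M) (u v : Π x : M, TangentSpace (𝓡 n) x),
    SmoothDiffCurve η → SmoothDiffCurve ξ → η 0 = ξ 0 → HasVelocity η u → HasVelocity ξ v →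
    Horizontal g a b c u → Horizontal g a b c v →
    G (jac g (η 0)) (fun x => deriv (fun s => jac g (η s) x) 0)
      (fun x => deriv (fun s => jac g (ξ s) x) 0) = abc g a b c u v

/-! ### The Euler-Arnold equation -/

/-- `B` represents `B(u, v)`: `⟨⟨B(u, v), w⟩⟩ = ⟨⟨u, ad_v w⟩⟩` for all `w ∈ T_e Diff(M)`.
(If the product is degenerate, `B(u, v)` is a class modulo the degenerate directions.) -/
def RepresentsB (g : RMetric n M) (a b c : ℝ) (u v B : Π x : M, TangentSpace (𝓡 n) x) : Prop :=
  SmoothField B ∧ ∀ w, SmoothField w → abc g a b c B w = abc g a b c u (adj v w)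

/-- Vector fields depending smoothly on `(t, x) ∈ J × M`. -/
def SmoothTimeField (J : Set ℝ) (u : ℝ → Π x : M, TangentSpace (𝓡 n) x) : Prop :=
  ContMDiffOn (𝓘(ℝ, ℝ).prod (𝓡 n)) (𝓡 n).tangent ∞
    (fun p : ℝ × M => (⟨p.2, u p.1 p.2⟩ : TangentBundle (𝓡 n) M)) (J ×ˢ univ)

/-- The time derivative `u_t`. -/
def timeDeriv (u : ℝ → Π x : M, TangentSpace (𝓡 n) x) (t : ℝ) (x : M) : TangentSpace (𝓡 n) x :=
  deriv (fun s => u s x) t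

/-- The Euler-Arnold equation `u_t = -B(u, u)` of the descended metric on `Diff(M)/Diff_μ(M)`:
the equality holds in `T_e Diff(M) / T_e Diff_μ(M)`. -/
def SolvesEulerArnold (g : RMetric n M) (a b c : ℝ) (J : Set ℝ)
    (u : ℝ → Π x : M, TangentSpace (𝓡 n) x) : Prop :=
  ∀ t ∈ J, ∃ B, RepresentsB g a b c (u t) (u t) B ∧ DivFree g (fun x => timeDeriv u t x + B x)

/-- `d div u_t + div u d div u + d ι_u (d div u) = 0`. -/
def SolvesDifferentiated (g : RMetric n M) (J : Set ℝ)
    (u : ℝ → Π x : M, TangentSpace (𝓡 n) x) : Prop :=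
  ∀ t ∈ J, ∀ x,
    dFun (n := n) (divg g (timeDeriv u t)) x + divg g (u t) x • dFun (divg g (u t)) x
      + dFun (fun y => dFun (divg g (u t)) y (u t y)) x = 0

/-- `ρ_t + u · ∇ρ + ρ²/2 = -∫ ρ² dμ / (2 μ(M))` with `ρ = div u`. -/
def SolvesHunterSaxton (g : RMetric n M) (J : Set ℝ)
    (u : ℝ → Π x : M, TangentSpace (𝓡 n) x) : Prop :=
  ∀ t ∈ J, ∀ x,
    deriv (fun s => divg g (u s) x) t + dFun (divg g (u t)) x (u t x) + divg g (u t) x ^ 2 / 2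
      = -(∫ y, divg g (u t) y ^ 2 ∂(vol g)) / (2 * (vol g).real univ)

end Geometry

end HunterSaxton

end

open HunterSaxton

/-! Since the codifferential of `flat g u` is `-divg g u`, the product with `a = c = 0` is `b ∫ div
u div v dμ`, and every claim becomes a statement about divergences. The main tool is the divergence
theorem `integral_mul_divg`, `∫ h div u dμ = -∫ dh(u) dμ`. As `μ` charges every open set, this weak
identity determines the continuous function `div u` (`eq_of_forall_integral_mul_eq`), so chart
independence, additivity, the bracket formula `divg_mlieBracket` and the first variation of the
Jacobian `deriv_jac` all follow by testing against smooth functions instead of changing coordinates.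

Bi-invariance: if `div w = 0`, then `div (ad_w u) = -w(div u)`, and the sum in question is `-b ∫
w(div u div v) dμ = 0`. Degeneracy: taking `v = u` forces `∫ (div u)² dμ = 0`.

Descent: the metric on densities is `G_R(f, h) = b ∫ f h / R dμ` (`densMetric`). Differentiating the
constant `∫ (k ∘ η_s) Jac(η_s) dμ = ∫ k dμ` gives `dπ(u ∘ η) = (div u ∘ η) Jac(η)`; substituted into
`G` at `R = Jac(η)`, one Jacobian cancels and the change of variables `integral_jac_mul_comp`
returns `b ∫ div u div v dμ`. Invariance of `G` is the same cancellation.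

Euler–Arnold: two integrations by parts give `⟨⟨u, ad_u w⟩⟩ = b ∫ K div w dμ` with `K = dρ(u) +
ρ²/2`, `ρ = div u` (`abc_adj_self`). Hence `B` represents `B(u, u)` exactly when `K - div B` is
orthogonal to all divergences. Such a function has zero differential
(`dFun_eq_zero_of_forall_integral_eq_zero`), so it is constant because `M` is connected. With `u_t +
B` divergence-free this reads `div u_t + K = const`; integration over `M` identifies the constant
and taking `d` gives the differentiated form. Conversely `B = -u_t` is a representative, so no
elliptic equation has to be solved for `B`. -/

noncomputable section

namespace HunterSaxton

/-! ### Metric, fields and differentials in the preferred charts -/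

section ChartCalculus

variable {n : ℕ} {M : Type*} [TopologicalSpace M] [ChartedSpace (Model n) M]

theorem sum_apply_smul_stdVec (v : Model n) : ∑ i, v i • (stdVec i : Model n) = v := by
  ext j
  simp [stdVec, Finset.sum_apply, Pi.single_apply]

@[simp] theorem stdVec_apply (i j : Fin n) : (stdVec i : Model n) j = if j = i then 1 else 0 := by
  simp [stdVec]

/-- The differential of the preferred chart at `c`. -/
def dchart (c x : M) : TangentSpace (𝓡 n) x →L[ℝ] Model n :=
  mfderiv (𝓡 n) (𝓡 n) (chartAt (Model n) c) x

theorem comp_apply (u : Π x : M, TangentSpace (𝓡 n) x) (c : M) (y : Model n) (i : Fin n) :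
    comp u c y i = dchart c ((chartAt (Model n) c).symm y) (u ((chartAt (Model n) c).symm y)) i :=
  rfl

variable [IsManifold (𝓡 n) ∞ M]

theorem mdifferentiable_chartAt (c : M) :
    (chartAt (Model n) c).MDifferentiable (𝓡 n) (𝓡 n) := by
  have : IsManifold (𝓡 n) 1 M := .of_le (n := ∞) (by exact_mod_cast le_top)
  exact mdifferentiable_chart c

theorem dchart_coordVec {c : M} {y : Model n} (hy : y ∈ (chartAt (Model n) c).target)
    (i : Fin n) : dchart c _ (coordVec c y i) = stdVec i := by
  have h := (mdifferentiable_chartAt c).comp_symm_deriv hy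
  exact DFunLike.congr_fun h (stdVec i : Model n)

theorem sum_dchart_smul_coordVec {c : M} {y : Model n} (hy : y ∈ (chartAt (Model n) c).target)
    (v : TangentSpace (𝓡 n) ((chartAt (Model n) c).symm y)) :
    ∑ i, dchart c _ v i • coordVec c y i = v := by
  have h := (mdifferentiable_chartAt c).symm_comp_deriv ((chartAt (Model n) c).map_target hy)
  have h' := DFunLike.congr_fun h v
  rw [(chartAt (Model n) c).right_inv hy] at h'
  have h2 : mfderiv (𝓡 n) (𝓡 n) (chartAt (Model n) c).symm y (dchart c _ v) = v := h'
  have h3 : (∑ i, dchart c _ v i • (stdVec i : Model n)) = dchart c _ v :=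
    sum_apply_smul_stdVec _
  rw [← h3] at h2
  have h4 := map_sum (mfderiv (𝓡 n) (𝓡 n) (chartAt (Model n) c).symm y)
    (fun i => (dchart c _ v i • (stdVec i : Model n) : Model n)) Finset.univ
  refine Eq.trans ?_ h2
  refine Eq.trans ?_ h4.symm
  refine Finset.sum_congr rfl fun i _ => ?_
  exact ((mfderiv (𝓡 n) (𝓡 n) (chartAt (Model n) c).symm y).map_smul _ _).symm

theorem contMDiffOn_chart_symm (c : M) :
    ContMDiffOn (𝓡 n) (𝓡 n) ∞ (chartAt (Model n) c).symm (chartAt (Model n) c).target :=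
  _root_.contMDiffOn_chart_symm

/-- Smoothness of a vector field along a map, read in the chart at `c`. -/
theorem contMDiffOn_iff_dchart {E' H' N : Type*} [NormedAddCommGroup E'] [NormedSpace ℝ E']
    [TopologicalSpace H'] (I' : ModelWithCorners ℝ E' H') [TopologicalSpace N] [ChartedSpace H' N]
    {s : Set N} {c : M} {p : N → M} {w : Π q : N, TangentSpace (𝓡 n) (p q)}
    (hp : MapsTo p s (chartAt (Model n) c).source) :
    ContMDiffOn I' (𝓡 n).tangent ∞ (fun q => (⟨p q, w q⟩ : TangentBundle (𝓡 n) M)) s ↔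
      ContMDiffOn I' (𝓡 n) ∞ p s ∧ ContMDiffOn I' 𝓘(ℝ, Model n) ∞ (fun q => dchart c (p q) (w q)) s := by
  have : IsManifold (𝓡 n) 1 M := .of_le (n := ∞) (by exact_mod_cast le_top)
  have key := Bundle.Trivialization.contMDiffOn_iff (IB := 𝓡 n) (IM := I') (n := ∞)
    (e := trivializationAt (Model n) (TangentSpace (𝓡 n) : M → Type _) c)
    (f := fun q => (⟨p q, w q⟩ : TangentBundle (𝓡 n) M)) (s := s)
    (fun q hq => by
      simpa [Bundle.Trivialization.mem_source] using hp hq)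
  refine key.trans (and_congr_right fun _ => contMDiffOn_congr fun q hq => ?_)
  have h := TangentBundle.continuousLinearMapAt_trivializationAt (I := 𝓡 n) (hp hq)
  have h2 := DFunLike.congr_fun h (w q)
  rw [Bundle.Trivialization.continuousLinearMapAt_apply,
    Bundle.Trivialization.coe_linearMapAt_of_mem] at h2
  · exact h2
  · simpa using hp hq

theorem coordVec_contMDiffOn (c : M) (i : Fin n) :
    ContMDiffOn (𝓡 n) (𝓡 n).tangent ∞
      (fun y => (⟨(chartAt (Model n) c).symm y, coordVec c y i⟩ : TangentBundle (𝓡 n) M))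
      (chartAt (Model n) c).target := by
  refine (contMDiffOn_iff_dchart (𝓡 n) (c := c) fun y hy =>
    (chartAt (Model n) c).map_target hy).2 ⟨contMDiffOn_chart_symm c, ?_⟩
  exact (contMDiffOn_const (c := (stdVec i : Model n))).congr fun y hy => dchart_coordVec hy i

theorem comp_contDiffOn {u : Π x : M, TangentSpace (𝓡 n) x} (hu : SmoothField u) (c : M)
    (i : Fin n) : ContDiffOn ℝ ∞ (fun y => comp u c y i) (chartAt (Model n) c).target := by
  have h1 : ContMDiffOn (𝓡 n) (𝓡 n).tangent ∞ (fun y => (⟨(chartAt (Model n) c).symm y,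
      u ((chartAt (Model n) c).symm y)⟩ : TangentBundle (𝓡 n) M)) (chartAt (Model n) c).target :=
    hu.comp_contMDiffOn (contMDiffOn_chart_symm c)
  have h2 := ((contMDiffOn_iff_dchart (𝓡 n) (c := c) fun y hy =>
    (chartAt (Model n) c).map_target hy).1 h1).2
  have h3 := (EuclideanSpace.proj (𝕜 := ℝ) i : Model n →L[ℝ] ℝ).contDiff.comp_contDiffOn h2.contDiffOn
  exact h3

theorem gram_contDiffOn (g : RMetric n M) (c : M) (i j : Fin n) :
    ContDiffOn ℝ ∞ (fun y => gram g c y i j) (chartAt (Model n) c).target := by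
  have h := ContMDiffOn.clm_bundle_apply₂
    (F₁ := Model n) (F₂ := Model n) (F₃ := ℝ) (E₁ := fun x : M => TangentSpace (𝓡 n) x)
    (E₂ := fun x : M => TangentSpace (𝓡 n) x) (E₃ := Bundle.Trivial M ℝ)
    (g.contMDiff.comp_contMDiffOn (contMDiffOn_chart_symm c))
    (coordVec_contMDiffOn c i) (coordVec_contMDiffOn c j)
  have h2 : ContMDiffOn (𝓡 n) 𝓘(ℝ, ℝ) ∞ (fun y => gram g c y i j) (chartAt (Model n) c).target := by
    intro y hy
    exact ((Bundle.contMDiffWithinAt_totalSpace).1 (h y hy)).2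
  exact h2.contDiffOn

theorem inner_sum_smul (g : RMetric n M) (x : M) (v : Fin n → TangentSpace (𝓡 n) x)
    (a b : Fin n → ℝ) :
    g.inner x (∑ i, a i • v i) (∑ j, b j • v j) =
      a ⬝ᵥ (Matrix.of fun i j => g.inner x (v i) (v j)).mulVec b := by
  simp only [map_sum, map_smul, sum_apply, smul_apply,
    smul_eq_mul, dotProduct, Matrix.mulVec, Matrix.of_apply, Finset.mul_sum]
  rw [Finset.sum_comm]
  refine Finset.sum_congr rfl fun i _ => Finset.sum_congr rfl fun j _ => by ring

/-- The quadratic form of the Gram matrix at `a` is the squared length of `∑ aᵢ vᵢ`. Arbitrary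
frames are allowed because Jacobians need more than coordinate frames. -/
theorem posDef_gram_of_linearIndependent (g : RMetric n M) (x : M)
    {v : Fin n → TangentSpace (𝓡 n) x} (hv : LinearIndependent ℝ v) :
    (Matrix.of fun i j => g.inner x (v i) (v j)).PosDef := by
  refine Matrix.PosDef.of_dotProduct_mulVec_pos ?_ fun a ha => ?_
  · ext i j
    simp [g.symm x (v j) (v i)]
  · rw [star_trivial, ← inner_sum_smul]
    refine g.pos x _ fun h0 => ha ?_
    exact funext fun i => Fintype.linearIndependent_iff.1 hv a h0 i

theorem linearIndependent_coordVec {c : M} {y : Model n}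
    (hy : y ∈ (chartAt (Model n) c).target) : LinearIndependent ℝ (coordVec c y) := by
  refine Fintype.linearIndependent_iff.2 fun a ha i => ?_
  have h := congrArg (fun v => dchart c _ v i) ha
  simpa [map_sum, dchart_coordVec hy] using h

theorem gram_posDef (g : RMetric n M) {c : M} {y : Model n}
    (hy : y ∈ (chartAt (Model n) c).target) : (gram g c y).PosDef :=
  posDef_gram_of_linearIndependent g _ (linearIndependent_coordVec hy)

theorem sqrtDet_pos (g : RMetric n M) {c : M} {y : Model n}
    (hy : y ∈ (chartAt (Model n) c).target) : 0 < sqrtDet g c y :=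
  Real.sqrt_pos.2 (gram_posDef g hy).det_pos

theorem sqrtDet_contDiffOn (g : RMetric n M) (c : M) :
    ContDiffOn ℝ ∞ (sqrtDet g c) (chartAt (Model n) c).target := by
  refine ContDiffOn.sqrt ?_ fun y hy => (gram_posDef g hy).det_pos.ne'
  simp only [Matrix.det_apply]
  refine ContDiffOn.sum fun σ _ => ContDiffOn.const_smul _ ?_
  exact contDiffOn_prod fun i _ => gram_contDiffOn g c _ _

/-- Lowering the index multiplies the components by the Gram matrix, and the codifferential
multiplies them by its inverse. The two cancel throughout the chart, so the functions being
differentiated agree near the point and `u` need not be smooth. -/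
theorem codiff_flat (g : RMetric n M) (u : Π x : M, TangentSpace (𝓡 n) x) (x : M) :
    codiff g (flat g u) x = -divg g u x := by
  have hmem : (chartAt (Model n) x).target ∈ 𝓝 (chartAt (Model n) x x) :=
    (chartAt (Model n) x).open_target.mem_nhds (mem_chart_target _ x)
  unfold codiff divg
  congr 2
  refine Finset.sum_congr rfl fun i _ => ?_
  unfold partialD
  congr 1
  refine Filter.EventuallyEq.fderiv_eq ?_
  filter_upwards [hmem] with y hy
  congr 1
  have hform : ∀ j, formComp (flat g u) x y j = ((gram g x y).mulVec (comp u x y)) j := by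
    intro j
    have h := sum_dchart_smul_coordVec hy (u ((chartAt (Model n) x).symm y))
    unfold formComp flat
    rw [g.symm]
    conv_lhs => rw [← h]
    simp only [map_sum, map_smul, smul_eq_mul, Matrix.mulVec, dotProduct, gram, Matrix.of_apply,
      comp_apply]
    exact Finset.sum_congr rfl fun k _ => mul_comm _ _
  have hu : IsUnit (gram g x y).det := (gram_posDef g hy).det_pos.ne'.isUnit
  have : ∀ i, ∑ j, (gram g x y)⁻¹ i j * formComp (flat g u) x y j
      = ((gram g x y)⁻¹.mulVec ((gram g x y).mulVec (comp u x y))) i := by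
    intro i
    simp only [hform]
    rfl
  rw [this, Matrix.mulVec_mulVec, Matrix.nonsing_inv_mul _ hu, Matrix.one_mulVec]

theorem dFun_chart {f : M → ℝ} {c : M} {y : Model n} (hy : y ∈ (chartAt (Model n) c).target)
    (hf : MDifferentiableAt (𝓡 n) 𝓘(ℝ, ℝ) f ((chartAt (Model n) c).symm y))
    (v : TangentSpace (𝓡 n) ((chartAt (Model n) c).symm y)) :
    dFun f _ v = fderiv ℝ (f ∘ (chartAt (Model n) c).symm) y (dchart c _ v) := by
  have h1 := ((mdifferentiable_chartAt c).mdifferentiableAt_symm hy)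
  have h2 := mfderiv_comp y hf h1
  have h3 := DFunLike.congr_fun ((mdifferentiable_chartAt c).symm_comp_deriv
    ((chartAt (Model n) c).map_target hy)) v
  rw [(chartAt (Model n) c).right_inv hy] at h3
  rw [mfderiv_eq_fderiv] at h2
  rw [h2]
  exact congrArg (dFun f _) h3.symm

theorem dFun_apply_eq_sum {f : M → ℝ} {c : M} {y : Model n}
    (hy : y ∈ (chartAt (Model n) c).target)
    (hf : MDifferentiableAt (𝓡 n) 𝓘(ℝ, ℝ) f ((chartAt (Model n) c).symm y))
    (u : Π x : M, TangentSpace (𝓡 n) x) :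
    dFun f _ (u ((chartAt (Model n) c).symm y)) =
      ∑ i, comp u c y i * partialD i (f ∘ (chartAt (Model n) c).symm) y := by
  rw [dFun_chart hy hf]
  conv_lhs => rw [← sum_apply_smul_stdVec (dchart c _ (u ((chartAt (Model n) c).symm y)))]
  simp only [map_sum, map_smul, smul_eq_mul]
  rfl

end ChartCalculus

/-! ### The Jacobian of a diffeomorphism -/

section Jacobian

theorem mdifferentiable_diffeo {n : ℕ} {M : Type*} [TopologicalSpace M]
    [ChartedSpace (Model n) M] (η : M ≃ₘ^∞⟮𝓡 n, 𝓡 n⟯ M) : MDifferentiable (𝓡 n) (𝓡 n) η :=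
  η.contMDiff.mdifferentiable (by simp)

theorem det_eq_det_matrix {n : ℕ} (L : Model n →L[ℝ] Model n) :
    L.det = (Matrix.of fun i j => L (stdVec i) j).det := by
  rw [ContinuousLinearMap.det, ← LinearMap.det_toMatrix (EuclideanSpace.basisFun (Fin n) ℝ).toBasis,
    ← Matrix.det_transpose]
  congr 1

variable {n : ℕ} {M : Type*} [TopologicalSpace M] [ChartedSpace (Model n) M]
  [IsManifold (𝓡 n) ∞ M]

/-- A change of frame by `A` turns the Gram matrix `G` into `A G Aᵀ`, whose determinant is `(det A)²
det G`. -/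
theorem volDensity_sum_smul (g : RMetric n M) (x : M) (w : Fin n → TangentSpace (𝓡 n) x)
    (A : Matrix (Fin n) (Fin n) ℝ) :
    volDensity g x (fun i => ∑ k, A i k • w k) = |A.det| * volDensity g x w := by
  have h : (Matrix.of fun i j => g.inner x (∑ k, A i k • w k) (∑ k, A j k • w k)) =
      A * (Matrix.of fun i j => g.inner x (w i) (w j)) * A.transpose := by
    ext i j
    rw [Matrix.of_apply, inner_sum_smul, Matrix.mul_assoc, Matrix.mul_apply]
    rfl
  unfold volDensity
  rw [h, Matrix.det_mul, Matrix.det_mul, Matrix.det_transpose,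
    show ∀ a b : ℝ, a * b * a = a ^ 2 * b by intros; ring, Real.sqrt_mul (sq_nonneg _),
    Real.sqrt_sq_eq_abs]

theorem volDensity_pos (g : RMetric n M) {x : M} {v : Fin n → TangentSpace (𝓡 n) x}
    (hv : LinearIndependent ℝ v) : 0 < volDensity g x v :=
  Real.sqrt_pos.2 (posDef_gram_of_linearIndependent g x hv).det_pos

theorem volDensity_eq_det_dchart (g : RMetric n M) {c x : M} (hx : x ∈ (chartAt (Model n) c).source)
    (v : Fin n → TangentSpace (𝓡 n) x) :
    volDensity g x v =
      |(Matrix.of fun i j => dchart c x (v i) j).det| * sqrtDet g c (chartAt (Model n) c x) := by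
  obtain ⟨y, hy, rfl⟩ : ∃ y ∈ (chartAt (Model n) c).target, (chartAt (Model n) c).symm y = x :=
    ⟨_, (chartAt (Model n) c).map_source hx, (chartAt (Model n) c).left_inv hx⟩
  rw [(chartAt (Model n) c).right_inv hy]
  conv_lhs => rw [show v = fun i => ∑ k, (Matrix.of fun i j => dchart c _ (v i) j) i k •
    coordVec c y k from funext fun i => (sum_dchart_smul_coordVec hy (v i)).symm]
  rw [volDensity_sum_smul]
  rfl

theorem linearIndependent_stdVec : LinearIndependent ℝ (stdVec : Fin n → Model n) := by
  refine Fintype.linearIndependent_iff.2 fun a ha i => ?_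
  have h := congrArg (fun v : Model n => v i) ha
  simpa using h

/-- Both densities scale by the same `|det A|` under a change of frame, so the ratio defining `jac`
does not depend on the standard basis. The chain rule and the chart formula follow by choosing
suitable frames here. -/
theorem jac_mul_volDensity (g : RMetric n M) (η : M ≃ₘ^∞⟮𝓡 n, 𝓡 n⟯ M) (x : M)
    (v : Fin n → TangentSpace (𝓡 n) x) :
    jac g η x * volDensity g x v =
      volDensity g (η x) (fun i => mfderiv (𝓡 n) (𝓡 n) η x (v i)) := by
  let e : Fin n → TangentSpace (𝓡 n) x := fun i => (stdVec i : Model n)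
  let v' : Fin n → Model n := v
  let A : Matrix (Fin n) (Fin n) ℝ := Matrix.of fun i k => v' i k
  have hv : v = fun i => ∑ k, A i k • e k :=
    funext fun i => (sum_apply_smul_stdVec (v' i)).symm
  have hw : (fun i => mfderiv (𝓡 n) (𝓡 n) η x (v i)) =
      fun i => ∑ k, A i k • mfderiv (𝓡 n) (𝓡 n) η x (e k) := by
    rw [hv]
    funext i
    rw [map_sum]
    exact Finset.sum_congr rfl fun k _ => map_smul _ _ _
  have hpos : 0 < volDensity g x e := volDensity_pos g linearIndependent_stdVec
  rw [hw, volDensity_sum_smul, hv, volDensity_sum_smul]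
  change volDensity g (η x) (fun i => mfderiv (𝓡 n) (𝓡 n) η x (e i)) / volDensity g x e * _ = _
  field_simp

theorem jac_pos (g : RMetric n M) (η : M ≃ₘ^∞⟮𝓡 n, 𝓡 n⟯ M) (x : M) : 0 < jac g η x := by
  refine div_pos (volDensity_pos g ?_) (volDensity_pos g linearIndependent_stdVec)
  -- The differential of `η.symm` is a left inverse.
  have hinj : Function.Injective (mfderiv (𝓡 n) (𝓡 n) η x) := by
    have h := mfderiv_comp x (mdifferentiable_diffeo η.symm (η x)) (mdifferentiable_diffeo η x)
    rw [show (η.symm ∘ η : M → M) = id from funext η.symm_apply_apply, mfderiv_id] at h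
    refine Function.LeftInverse.injective (g := mfderiv (𝓡 n) (𝓡 n) η.symm (η x)) fun v => ?_
    exact (DFunLike.congr_fun h v).symm
  exact linearIndependent_stdVec.map' (mfderiv (𝓡 n) (𝓡 n) η x).toLinearMap
    (LinearMap.ker_eq_bot.2 hinj)

theorem jac_refl (g : RMetric n M) (x : M) : jac g (Diffeomorph.refl (𝓡 n) M ∞) x = 1 := by
  have h := jac_mul_volDensity g (Diffeomorph.refl (𝓡 n) M ∞) x
    (fun i => (stdVec i : Model n))
  have hpos : 0 < volDensity g x (fun i => (stdVec i : Model n)) :=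
    volDensity_pos g linearIndependent_stdVec
  refine mul_right_cancel₀ hpos.ne' (h.trans ?_)
  rw [one_mul, show (Diffeomorph.refl (𝓡 n) M ∞ : M → M) = id from rfl, mfderiv_id]
  rfl

theorem jac_trans (g : RMetric n M) (η ξ : M ≃ₘ^∞⟮𝓡 n, 𝓡 n⟯ M) (x : M) :
    jac g (η.trans ξ) x = jac g ξ (η x) * jac g η x := by
  have h1 := jac_mul_volDensity g (η.trans ξ) x (fun i => (stdVec i : Model n))
  have h2 := jac_mul_volDensity g η x (fun i => (stdVec i : Model n))
  have h3 := jac_mul_volDensity g ξ (η x)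
    (fun i => mfderiv (𝓡 n) (𝓡 n) η x (stdVec i : Model n))
  have hpos : 0 < volDensity g x (fun i => (stdVec i : Model n)) :=
    volDensity_pos g linearIndependent_stdVec
  refine mul_right_cancel₀ hpos.ne' ?_
  rw [mul_assoc, h2, h3, h1]
  have h := mfderiv_comp x (mdifferentiable_diffeo ξ (η x)) (mdifferentiable_diffeo η x)
  rw [show (η.trans ξ : M → M) = ξ ∘ η from rfl, h]
  rfl

/-- The coordinate frame of the chart at `c` is the frame for which the source density is `sqrtDet`.
This links `jac` to the Euclidean change of variables formula. -/
theorem jac_chart (g : RMetric n M) (η : M ≃ₘ^∞⟮𝓡 n, 𝓡 n⟯ M) {c c' : M} {y : Model n}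
    (hy : y ∈ (chartAt (Model n) c).target)
    (hz : η ((chartAt (Model n) c).symm y) ∈ (chartAt (Model n) c').source) :
    jac g η ((chartAt (Model n) c).symm y) * sqrtDet g c y =
      sqrtDet g c' (chartAt (Model n) c' (η ((chartAt (Model n) c).symm y))) *
        |(fderiv ℝ (fun y => chartAt (Model n) c' (η ((chartAt (Model n) c).symm y))) y).det| := by
  refine (jac_mul_volDensity g η _ (coordVec c y)).trans ?_
  rw [volDensity_eq_det_dchart g hz, mul_comm]
  congr 2
  have hd : ∀ v : Model n, fderiv ℝ (fun y => chartAt (Model n) c' (η ((chartAt (Model n) c).symm y))) y v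
      = dchart c' _ (mfderiv (𝓡 n) (𝓡 n) η _ (mfderiv (𝓡 n) (𝓡 n) (chartAt (Model n) c).symm y v)) := by
    intro v
    have h1 := ((mdifferentiable_chartAt c).mdifferentiableAt_symm hy)
    have h2 := mfderiv_comp y (mdifferentiable_diffeo η _) h1
    have h3 := mfderiv_comp y (g := chartAt (Model n) c') (f := η ∘ (chartAt (Model n) c).symm)
      ((mdifferentiable_chartAt c').mdifferentiableAt hz) ((mdifferentiable_diffeo η _).comp y h1)
    rw [mfderiv_eq_fderiv, h2] at h3
    exact DFunLike.congr_fun h3 v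
  rw [det_eq_det_matrix]
  simp only [hd, coordVec]

end Jacobian

/-! ### Smooth families: charts on the product of time and space -/

section ProductCharts

variable {n : ℕ} {M : Type*} [TopologicalSpace M] [ChartedSpace (Model n) M]

theorem contMDiffOn_prod_iff_contDiffOn {E F : Type*} [NormedAddCommGroup E] [NormedSpace ℝ E]
    [NormedAddCommGroup F] [NormedSpace ℝ F] {f : ℝ × E → F} {s : Set (ℝ × E)} :
    ContMDiffOn (𝓘(ℝ, ℝ).prod 𝓘(ℝ, E)) 𝓘(ℝ, F) ∞ f s ↔ ContDiffOn ℝ ∞ f s := by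
  rw [← contMDiffOn_iff_contDiffOn, modelWithCornersSelf_prod, ← chartedSpaceSelf_prod]

theorem contMDiffAt_prod_iff_contDiffAt {E F : Type*} [NormedAddCommGroup E] [NormedSpace ℝ E]
    [NormedAddCommGroup F] [NormedSpace ℝ F] {f : ℝ × E → F} {p : ℝ × E} :
    ContMDiffAt (𝓘(ℝ, ℝ).prod 𝓘(ℝ, E)) 𝓘(ℝ, F) ∞ f p ↔ ContDiffAt ℝ ∞ f p := by
  rw [← contMDiffAt_iff_contDiffAt, modelWithCornersSelf_prod, ← chartedSpaceSelf_prod]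

theorem isOpen_prod_target {J : Set ℝ} (hJ : IsOpen J) (c : M) :
    IsOpen (J ×ˢ (chartAt (Model n) c).target) := hJ.prod (chartAt (Model n) c).open_target

variable [IsManifold (𝓡 n) ∞ M]

theorem contMDiffAt_prod_iff_chart {f : ℝ × M → ℝ} {t : ℝ} {c : M} {y : Model n}
    (hy : y ∈ (chartAt (Model n) c).target) :
    ContMDiffAt (𝓘(ℝ, ℝ).prod (𝓡 n)) 𝓘(ℝ, ℝ) ∞ f (t, (chartAt (Model n) c).symm y) ↔
      ContDiffAt ℝ ∞ (fun p : ℝ × Model n => f (p.1, (chartAt (Model n) c).symm p.2)) (t, y) := by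
  rw [← contMDiffAt_prod_iff_contDiffAt]
  constructor
  · intro h
    have h2 : ContMDiffAt (𝓘(ℝ, ℝ).prod (𝓡 n)) (𝓘(ℝ, ℝ).prod (𝓡 n)) ∞
        (fun p : ℝ × Model n => (p.1, (chartAt (Model n) c).symm p.2)) (t, y) :=
      contMDiffAt_fst.prodMk (ContMDiffAt.comp (t, y)
        ((contMDiffOn_chart_symm c).contMDiffAt
          ((chartAt (Model n) c).open_target.mem_nhds hy)) contMDiffAt_snd)
    exact ContMDiffAt.comp (t, y) h h2
  · intro h
    have hx := (chartAt (Model n) c).map_target hy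
    have h2 : ContMDiffAt (𝓘(ℝ, ℝ).prod (𝓡 n)) (𝓘(ℝ, ℝ).prod (𝓡 n)) ∞
        (fun p : ℝ × M => (p.1, chartAt (Model n) c p.2)) (t, (chartAt (Model n) c).symm y) :=
      contMDiffAt_fst.prodMk (ContMDiffAt.comp (t, (chartAt (Model n) c).symm y)
        (contMDiffOn_chart.contMDiffAt
          ((chartAt (Model n) c).open_source.mem_nhds hx)) contMDiffAt_snd)
    have h' : ContMDiffAt (𝓘(ℝ, ℝ).prod (𝓡 n)) 𝓘(ℝ, ℝ) ∞
        (fun p : ℝ × Model n => f (p.1, (chartAt (Model n) c).symm p.2))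
        (t, chartAt (Model n) c ((chartAt (Model n) c).symm y)) := by
      rwa [(chartAt (Model n) c).right_inv hy]
    refine (ContMDiffAt.comp (t, (chartAt (Model n) c).symm y) h' h2).congr_of_eventuallyEq ?_
    filter_upwards [continuous_snd.continuousAt.preimage_mem_nhds
      ((chartAt (Model n) c).open_source.mem_nhds hx)] with p hp
    simp only [Function.comp, (chartAt (Model n) c).left_inv hp]

theorem contMDiffAt_prod_iff_chart' {f : ℝ × M → ℝ} {t : ℝ} {c x : M}
    (hx : x ∈ (chartAt (Model n) c).source) :
    ContMDiffAt (𝓘(ℝ, ℝ).prod (𝓡 n)) 𝓘(ℝ, ℝ) ∞ f (t, x) ↔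
      ContDiffAt ℝ ∞ (fun p : ℝ × Model n => f (p.1, (chartAt (Model n) c).symm p.2))
        (t, chartAt (Model n) c x) := by
  rw [← contMDiffAt_prod_iff_chart ((chartAt (Model n) c).map_source hx),
    (chartAt (Model n) c).left_inv hx]

theorem contMDiffAt_iff_chart {f : M → ℝ} {c : M} {y : Model n}
    (hy : y ∈ (chartAt (Model n) c).target) :
    ContMDiffAt (𝓡 n) 𝓘(ℝ, ℝ) ∞ f ((chartAt (Model n) c).symm y) ↔
      ContDiffAt ℝ ∞ (fun y => f ((chartAt (Model n) c).symm y)) y := by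
  rw [← contMDiffAt_iff_contDiffAt]
  constructor
  · intro h
    exact ContMDiffAt.comp y h ((contMDiffOn_chart_symm c).contMDiffAt
          ((chartAt (Model n) c).open_target.mem_nhds hy))
  · intro h
    have hx := (chartAt (Model n) c).map_target hy
    have h' : ContMDiffAt (𝓡 n) 𝓘(ℝ, ℝ) ∞ (fun y => f ((chartAt (Model n) c).symm y))
        (chartAt (Model n) c ((chartAt (Model n) c).symm y)) := by
      rwa [(chartAt (Model n) c).right_inv hy]
    refine (ContMDiffAt.comp ((chartAt (Model n) c).symm y) h' (contMDiffOn_chart.contMDiffAt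
          ((chartAt (Model n) c).open_source.mem_nhds hx))).congr_of_eventuallyEq ?_
    filter_upwards [(chartAt (Model n) c).open_source.mem_nhds hx] with p hp
    simp only [Function.comp, (chartAt (Model n) c).left_inv hp]

theorem contDiffOn_fderiv_apply {E F : Type*} [NormedAddCommGroup E] [NormedSpace ℝ E]
    [NormedAddCommGroup F] [NormedSpace ℝ F] {f : E → F} {s : Set E} (hs : IsOpen s)
    (hf : ContDiffOn ℝ ∞ f s) (v : E) : ContDiffOn ℝ ∞ (fun x => fderiv ℝ f x v) s :=
  (hf.fderiv_of_isOpen hs (by simp)).clm_apply contDiffOn_const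

theorem fderiv_curry_right {E F : Type*} [NormedAddCommGroup E] [NormedSpace ℝ E]
    [NormedAddCommGroup F] [NormedSpace ℝ F] {f : ℝ × E → F} {t : ℝ} {y : E}
    (hf : DifferentiableAt ℝ f (t, y)) (v : E) :
    fderiv ℝ (fun y => f (t, y)) y v = fderiv ℝ f (t, y) (0, v) := by
  have h := (hf.hasFDerivAt.comp y (hasFDerivAt_prodMk_right t y)).fderiv
  rw [show (fun y => f (t, y)) = f ∘ Prod.mk t from rfl, h]
  rfl

theorem hasDerivAt_curry_left {E F : Type*} [NormedAddCommGroup E] [NormedSpace ℝ E]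
    [NormedAddCommGroup F] [NormedSpace ℝ F] {f : ℝ × E → F} {t : ℝ} {y : E}
    (hf : DifferentiableAt ℝ f (t, y)) :
    HasDerivAt (fun s => f (s, y)) (fderiv ℝ f (t, y) (1, 0)) t := by
  have h := (hf.hasFDerivAt.comp t (hasFDerivAt_prodMk_left t y)).hasDerivAt
  exact h

/-- Time derivatives and space derivatives commute. -/
theorem hasDerivAt_fderiv_curry {E F : Type*} [NormedAddCommGroup E] [NormedSpace ℝ E]
    [NormedAddCommGroup F] [NormedSpace ℝ F] {f : ℝ × E → F} {s : Set (ℝ × E)} (hs : IsOpen s)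
    (hf : ContDiffOn ℝ ∞ f s) {t : ℝ} {y : E} (h : (t, y) ∈ s) (v : E) :
    HasDerivAt (fun r => fderiv ℝ (fun y => f (r, y)) y v)
      (fderiv ℝ (fun y => deriv (fun r => f (r, y)) t) y v) t := by
  have hd : ∀ p ∈ s, DifferentiableAt ℝ f p := fun p hp =>
    (hf.contDiffAt (hs.mem_nhds hp)).differentiableAt (by simp)
  have hd1 : ∀ w, DifferentiableAt ℝ (fun p => fderiv ℝ f p w) (t, y) := fun w =>
    ((contDiffOn_fderiv_apply hs hf w).contDiffAt (hs.mem_nhds h)).differentiableAt (by simp)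
  have hd2 : DifferentiableAt ℝ (fderiv ℝ f) (t, y) :=
    ((hf.fderiv_of_isOpen hs (m := ∞) (by simp)).contDiffAt (hs.mem_nhds h)).differentiableAt
      (by simp)
  -- Both sides of the claim are values of the second derivative on `(1, 0)` and `(0, v)`, in
  -- opposite orders.
  have hsymm : IsSymmSndFDerivAt ℝ f (t, y) :=
    (hf.contDiffAt (hs.mem_nhds h)).isSymmSndFDerivAt
      (by simpa using (WithTop.coe_le_coe.2 le_top : ((2 : ℕ∞) : WithTop ℕ∞) ≤ ∞))
  have e1 : (fun r => fderiv ℝ (fun y => f (r, y)) y v) =ᶠ[𝓝 t]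
      fun r => fderiv ℝ f (r, y) (0, v) := by
    have : ∀ᶠ r in 𝓝 t, (r, y) ∈ s :=
      (Continuous.prodMk_left y).continuousAt.preimage_mem_nhds (hs.mem_nhds h)
    filter_upwards [this] with r hr using fderiv_curry_right (hd _ hr) v
  have e2 : (fun z => deriv (fun r => f (r, z)) t) =ᶠ[𝓝 y]
      fun z => fderiv ℝ f (t, z) (1, 0) := by
    have : ∀ᶠ z in 𝓝 y, (t, z) ∈ s :=
      (Continuous.prodMk_right t).continuousAt.preimage_mem_nhds (hs.mem_nhds h)
    filter_upwards [this] with z hz using (hasDerivAt_curry_left (hd _ hz)).deriv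
  rw [e2.fderiv_eq, fderiv_curry_right (f := fun p => fderiv ℝ f p (1, 0)) (hd1 _)]
  refine HasDerivAt.congr_of_eventuallyEq ?_ e1
  convert hasDerivAt_curry_left (f := fun p => fderiv ℝ f p (0, v)) (hd1 _) using 1
  have h3 : ∀ w w', fderiv ℝ (fun p => fderiv ℝ f p w) (t, y) w' =
      fderiv ℝ (fderiv ℝ f) (t, y) w' w := fun w w' => by
    rw [fderiv_clm_apply hd2 (differentiableAt_const w)]
    simp
  rw [h3, h3]
  exact hsymm _ _

/-- The time derivative of a smooth family of functions is a smooth family of functions. -/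
theorem deriv_fst_contMDiffOn {J : Set ℝ} (hJ : IsOpen J) {f : ℝ × M → ℝ}
    (hf : ContMDiffOn (𝓘(ℝ, ℝ).prod (𝓡 n)) 𝓘(ℝ, ℝ) ∞ f (J ×ˢ univ)) :
    ContMDiffOn (𝓘(ℝ, ℝ).prod (𝓡 n)) 𝓘(ℝ, ℝ) ∞
      (fun p : ℝ × M => deriv (fun s => f (s, p.2)) p.1) (J ×ˢ univ) := by
  rintro ⟨t, x⟩ ⟨ht, -⟩
  refine ContMDiffAt.contMDiffWithinAt ?_
  have hx := (chartAt (Model n) x).map_source (mem_chart_source _ x)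
  refine (contMDiffAt_prod_iff_chart' (mem_chart_source (Model n) x)).2 ?_
  have hop := isOpen_prod_target (n := n) hJ x
  have h1 : ContDiffOn ℝ ∞ (fun p : ℝ × Model n => f (p.1, (chartAt (Model n) x).symm p.2))
      (J ×ˢ (chartAt (Model n) x).target) := by
    rintro ⟨s, y⟩ ⟨hs, hy⟩
    exact ((contMDiffAt_prod_iff_chart hy).1 (hf.contMDiffAt
      ((hJ.prod isOpen_univ).mem_nhds ⟨hs, mem_univ _⟩))).contDiffWithinAt
  refine ContDiffOn.contDiffAt (s := J ×ˢ (chartAt (Model n) x).target) ?_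
    (hop.mem_nhds ⟨ht, hx⟩)
  refine (contDiffOn_fderiv_apply hop h1 (1, 0)).congr ?_
  rintro ⟨s, y⟩ hp
  exact (hasDerivAt_curry_left ((h1.contDiffAt (hop.mem_nhds hp)).differentiableAt (by simp))).deriv

/-- By `jac_chart` the Jacobian is, near a given time and point, a quotient of smooth functions
times the absolute value of a determinant. That absolute value is smooth because positivity of `jac`
keeps the determinant away from zero. -/
theorem jac_contMDiff_curve (g : RMetric n M) {η : ℝ → M ≃ₘ^∞⟮𝓡 n, 𝓡 n⟯ M}
    (hη : SmoothDiffCurve η) : SmoothFunCurve (n := n) (fun s => jac g (η s)) := by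
  rintro ⟨t, x⟩
  let c := x
  let c' := η t x
  have hx := (chartAt (Model n) c).map_source (mem_chart_source _ x)
  refine (contMDiffAt_prod_iff_chart' (mem_chart_source (Model n) x)).2 ?_
  have hF : ContMDiffOn (𝓘(ℝ, ℝ).prod (𝓡 n)) (𝓡 n) ∞
      (fun p : ℝ × Model n => η p.1 ((chartAt (Model n) c).symm p.2))
      (univ ×ˢ (chartAt (Model n) c).target) := by
    have h2 : ContMDiffOn (𝓘(ℝ, ℝ).prod (𝓡 n)) (𝓘(ℝ, ℝ).prod (𝓡 n)) ∞
        (fun p : ℝ × Model n => (p.1, (chartAt (Model n) c).symm p.2))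
        (univ ×ˢ (chartAt (Model n) c).target) :=
      contMDiffOn_fst.prodMk ((contMDiffOn_chart_symm c).comp contMDiffOn_snd fun p hp => hp.2)
    exact ContMDiff.comp_contMDiffOn (g := fun p : ℝ × M => η p.1 p.2) hη h2
  -- `W` is the open set of times and points on which the fixed charts at `x` and at `η t x` both
  -- apply.
  set W := (univ ×ˢ (chartAt (Model n) c).target) ∩
    (fun p : ℝ × Model n => η p.1 ((chartAt (Model n) c).symm p.2)) ⁻¹' (chartAt (Model n) c').source
  have hW : IsOpen W := hF.continuousOn.isOpen_inter_preimage
    (isOpen_prod_target isOpen_univ c) (chartAt (Model n) c').open_source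
  set T := fun p : ℝ × Model n => chartAt (Model n) c' (η p.1 ((chartAt (Model n) c).symm p.2))
  have hT : ContDiffOn ℝ ∞ T W := contMDiffOn_prod_iff_contDiffOn.1
    (contMDiffOn_chart.comp (hF.mono inter_subset_left) inter_subset_right)
  have hmem : (t, chartAt (Model n) c x) ∈ W := by
    refine ⟨⟨mem_univ _, hx⟩, ?_⟩
    simp only [mem_preimage]
    rw [(chartAt (Model n) c).left_inv (mem_chart_source (Model n) x)]
    exact mem_chart_source _ _
  have hTd : ∀ p ∈ W, DifferentiableAt ℝ T p := fun p hp =>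
    (hT.contDiffAt (hW.mem_nhds hp)).differentiableAt (by simp)
  have hdet : ContDiffOn ℝ ∞ (fun p : ℝ × Model n =>
      (fderiv ℝ (fun y => T (p.1, y)) p.2).det) W := by
    simp only [det_eq_det_matrix, Matrix.det_apply]
    refine ContDiffOn.sum fun σ _ => ContDiffOn.const_smul _ (contDiffOn_prod fun i _ => ?_)
    refine (((EuclideanSpace.proj (𝕜 := ℝ) i : Model n →L[ℝ] ℝ)).contDiff.comp_contDiffOn
      (contDiffOn_fderiv_apply hW hT (0, stdVec (σ i)))).congr fun p hp => ?_
    simp only [Matrix.of_apply]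
    rw [fderiv_curry_right (hTd p hp)]
    rfl
  have hform : ∀ p ∈ W, jac g (η p.1) ((chartAt (Model n) c).symm p.2) * sqrtDet g c p.2 =
      sqrtDet g c' (T p) * |(fderiv ℝ (fun y => T (p.1, y)) p.2).det| := fun p hp =>
    jac_chart g (η p.1) hp.1.2 hp.2
  have hTmem : MapsTo T W (chartAt (Model n) c').target := fun p hp =>
    (chartAt (Model n) c').map_source hp.2
  have hne : ∀ p ∈ W, (fderiv ℝ (fun y => T (p.1, y)) p.2).det ≠ 0 := fun p hp h0 => by
    have h1 := mul_pos (jac_pos g (η p.1) ((chartAt (Model n) c).symm p.2)) (sqrtDet_pos g hp.1.2)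
    rw [hform p hp, h0] at h1
    simp at h1
  have hcd : ContDiffOn ℝ ∞ (fun p : ℝ × Model n =>
      sqrtDet g c' (T p) * |(fderiv ℝ (fun y => T (p.1, y)) p.2).det| / sqrtDet g c p.2) W := by
    refine ContDiffOn.div (((sqrtDet_contDiffOn g c').comp hT hTmem).mul ?_) ?_ ?_
    · exact hdet.abs hne
    · exact (sqrtDet_contDiffOn g c).comp contDiffOn_snd fun p hp => hp.1.2
    · exact fun p hp => (sqrtDet_pos g hp.1.2).ne'
  refine (hcd.congr fun p hp => ?_).contDiffAt (hW.mem_nhds hmem)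
  rw [← hform p hp, mul_div_cancel_right₀ _ (sqrtDet_pos g hp.1.2).ne']

omit [IsManifold (𝓡 n) ∞ M] in
theorem SmoothFunCurve.slice {F : ℝ → M → ℝ} (hF : SmoothFunCurve (n := n) F) (t : ℝ) :
    ContMDiff (𝓡 n) 𝓘(ℝ, ℝ) ∞ (F t) := by
  have h2 : ContMDiff (𝓡 n) (𝓘(ℝ, ℝ).prod (𝓡 n)) ∞ (fun x : M => (t, x)) :=
    contMDiff_const.prodMk contMDiff_id
  exact ContMDiff.comp (g := fun p : ℝ × M => F p.1 p.2) hF h2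

omit [IsManifold (𝓡 n) ∞ M] in
theorem smoothDiffCurve_const (η : M ≃ₘ^∞⟮𝓡 n, 𝓡 n⟯ M) : SmoothDiffCurve (fun _ : ℝ => η) :=
  ContMDiff.comp (g := (η : M → M)) (f := Prod.snd) η.contMDiff contMDiff_snd

theorem jac_contMDiff (g : RMetric n M) (η : M ≃ₘ^∞⟮𝓡 n, 𝓡 n⟯ M) :
    ContMDiff (𝓡 n) 𝓘(ℝ, ℝ) ∞ (jac g η) :=
  (jac_contMDiff_curve g (smoothDiffCurve_const η)).slice 0

end ProductCharts

/-! ### The Riemannian volume and change of variables -/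

section Volume

theorem setLIntegral_eq_of_support {n : ℕ} {s t : Set (Model n)} (hts : t ⊆ s) (hs : MeasurableSet s)
    (ht : MeasurableSet t) {f : Model n → ENNReal} (hf : ∀ y ∈ s, y ∉ t → f y = 0) :
    ∫⁻ y in s, f y = ∫⁻ y in t, f y := by
  rw [← lintegral_indicator hs, ← lintegral_indicator ht]
  refine lintegral_congr fun y => ?_
  by_cases hy : y ∈ t
  · rw [indicator_of_mem hy, indicator_of_mem (hts hy)]
  · rw [indicator_of_notMem hy]
    by_cases hy' : y ∈ s
    · rw [indicator_of_mem hy', hf y hy' hy]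
    · rw [indicator_of_notMem hy']

theorem aemeasurable_chart_symm {n : ℕ} {M : Type*} [TopologicalSpace M]
    [ChartedSpace (Model n) M] [MeasurableSpace M] [BorelSpace M] (c : M) : AEMeasurable (chartAt (Model n) c).symm
    ((volume : Measure (Model n)).restrict (chartAt (Model n) c).target) :=
  (chartAt (Model n) c).continuousOn_symm.aemeasurable (chartAt (Model n) c).open_target.measurableSet

variable {n : ℕ} {M : Type*} [TopologicalSpace M] [ChartedSpace (Model n) M]
  [IsManifold (𝓡 n) ∞ M] [CompactSpace M] [T2Space M]

theorem tsupport_chartPartition_subset (c : M) :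
    tsupport (chartPartition n M c) ⊆ (chartAt (Model n) c).source :=
  Classical.choose_spec (SmoothPartitionOfUnity.exists_isSubordinate_chartAt_source (𝓡 n) M) c

theorem chartPartition_contMDiff (c : M) :
    ContMDiff (𝓡 n) 𝓘(ℝ, ℝ) ∞ (chartPartition n M c) := (chartPartition n M c).contMDiff

variable (n M) in
theorem finite_support_chartPartition :
    {c : M | (Function.support (chartPartition n M c)).Nonempty}.Finite :=
  (chartPartition n M).locallyFinite.finite_nonempty_of_compact

variable (n M) in
/-- The finitely many indices of the nonzero members of the partition of unity. -/
def chartIndices : Finset M := (finite_support_chartPartition n M).toFinset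

theorem chartPartition_eq_zero {c : M} (hc : c ∉ chartIndices n M) (x : M) :
    chartPartition n M c x = 0 := by
  by_contra h
  exact hc ((finite_support_chartPartition n M).mem_toFinset.2 ⟨x, h⟩)

theorem sum_chartPartition (x : M) : ∑ c ∈ chartIndices n M, chartPartition n M c x = 1 := by
  rw [← (chartPartition n M).sum_eq_one (mem_univ x)]
  refine (finsum_eq_sum_of_support_subset _ fun c hc => ?_).symm
  by_contra h
  exact hc (chartPartition_eq_zero h x)

theorem chartPartition_nonneg (c x : M) : 0 ≤ chartPartition n M c x :=
  (chartPartition n M).nonneg c x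

theorem continuousOn_density (g : RMetric n M) (c : M) :
    ContinuousOn (fun y => chartPartition n M c ((chartAt (Model n) c).symm y) * sqrtDet g c y)
      (chartAt (Model n) c).target :=
  ((chartPartition_contMDiff c).continuous.comp_continuousOn
    (chartAt (Model n) c).continuousOn_symm).mul (sqrtDet_contDiffOn g c).continuousOn

variable [MeasurableSpace M] [BorelSpace M]

/-- The sum defining `vol` runs over all points of `M`, but compactness leaves only finitely many
nonzero members of the partition of unity. -/
theorem lintegral_vol (g : RMetric n M) {h : M → ENNReal} (hh : Measurable h) :
    ∫⁻ x, h x ∂(vol g) = ∑ c ∈ chartIndices n M, ∫⁻ y in (chartAt (Model n) c).target,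
      ENNReal.ofReal (chartPartition n M c ((chartAt (Model n) c).symm y) * sqrtDet g c y) *
        h ((chartAt (Model n) c).symm y) := by
  have hmeas : ∀ c : M, AEMeasurable (fun y => ENNReal.ofReal
      (chartPartition n M c ((chartAt (Model n) c).symm y) * sqrtDet g c y))
      ((volume : Measure (Model n)).restrict (chartAt (Model n) c).target) := fun c =>
    ((continuousOn_density g c).aemeasurable
      (chartAt (Model n) c).open_target.measurableSet).ennreal_ofReal
  have hc : ∀ c : M, ∫⁻ x, h x ∂((((volume : Measure (Model n)).restrict
      (chartAt (Model n) c).target).withDensity (fun y => ENNReal.ofReal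
        (chartPartition n M c ((chartAt (Model n) c).symm y) * sqrtDet g c y))).map
      (chartAt (Model n) c).symm) = ∫⁻ y in (chartAt (Model n) c).target,
      ENNReal.ofReal (chartPartition n M c ((chartAt (Model n) c).symm y) * sqrtDet g c y) *
        h ((chartAt (Model n) c).symm y) := by
    intro c
    rw [lintegral_map' hh.aemeasurable
      ((aemeasurable_chart_symm c).mono_ac (withDensity_absolutelyContinuous _ _))]
    exact lintegral_withDensity_eq_lintegral_mul₀ (hmeas c)
      (hh.comp_aemeasurable (aemeasurable_chart_symm c))
  rw [vol, lintegral_sum_measure, tsum_eq_sum (s := chartIndices n M)]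
  · exact Finset.sum_congr rfl fun c _ => hc c
  · intro c hcn
    rw [hc]
    simp [chartPartition_eq_zero hcn]

omit [CompactSpace M] [T2Space M] [MeasurableSpace M] [BorelSpace M] in
/-- Change of variables for a diffeomorphism in a pair of charts. -/
theorem lintegral_chart_diffeo (g : RMetric n M) (η : M ≃ₘ^∞⟮𝓡 n, 𝓡 n⟯ M) (c c' : M)
    (h : M → ENNReal) :
    ∫⁻ y in (chartAt (Model n) c).target ∩
        (chartAt (Model n) c).symm ⁻¹' (η ⁻¹' (chartAt (Model n) c').source),
      ENNReal.ofReal (jac g η ((chartAt (Model n) c).symm y) * sqrtDet g c y) *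
        h (η ((chartAt (Model n) c).symm y)) =
    ∫⁻ z in (chartAt (Model n) c').target ∩
        (chartAt (Model n) c').symm ⁻¹' (η.symm ⁻¹' (chartAt (Model n) c).source),
      ENNReal.ofReal (sqrtDet g c' z) * h ((chartAt (Model n) c').symm z) := by
  set U := (chartAt (Model n) c).target ∩
    (chartAt (Model n) c).symm ⁻¹' (η ⁻¹' (chartAt (Model n) c').source) with hU
  set T : Model n → Model n := fun y => chartAt (Model n) c' (η ((chartAt (Model n) c).symm y))
    with hT
  have hUo : IsOpen U := (chartAt (Model n) c).continuousOn_symm.isOpen_inter_preimage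
    (chartAt (Model n) c).open_target
    ((chartAt (Model n) c').open_source.preimage η.contMDiff.continuous)
  have hTd : ∀ y ∈ U, HasFDerivWithinAt T (fderiv ℝ T y) U y := by
    intro y hy
    have h1 := ((mdifferentiable_chartAt c).mdifferentiableAt_symm hy.1)
    have h2 := ((mdifferentiable_chartAt c').mdifferentiableAt hy.2).comp y
      ((mdifferentiable_diffeo η _).comp y h1)
    exact h2.differentiableAt.hasFDerivAt.hasFDerivWithinAt
  have hinj : InjOn T U := by
    intro y hy y' hy' h
    have h1 := (chartAt (Model n) c').injOn hy.2 hy'.2 h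
    have h2 := η.injective h1
    exact (chartAt (Model n) c).symm.injOn hy.1 hy'.1 h2
  have himage : T '' U = (chartAt (Model n) c').target ∩
      (chartAt (Model n) c').symm ⁻¹' (η.symm ⁻¹' (chartAt (Model n) c).source) := by
    ext z
    constructor
    · rintro ⟨y, hy, rfl⟩
      refine ⟨(chartAt (Model n) c').map_source hy.2, ?_⟩
      simp only [mem_preimage, hT]
      rw [(chartAt (Model n) c').left_inv hy.2, η.symm_apply_apply]
      exact (chartAt (Model n) c).map_target hy.1
    · rintro ⟨hz, hz2⟩
      refine ⟨chartAt (Model n) c (η.symm ((chartAt (Model n) c').symm z)), ⟨?_, ?_⟩, ?_⟩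
      · exact (chartAt (Model n) c).map_source hz2
      · simp only [mem_preimage]
        rw [(chartAt (Model n) c).left_inv hz2, η.apply_symm_apply]
        exact (chartAt (Model n) c').map_target hz
      · simp only [hT]
        rw [(chartAt (Model n) c).left_inv hz2, η.apply_symm_apply,
          (chartAt (Model n) c').right_inv hz]
  rw [← himage, lintegral_image_eq_lintegral_abs_det_fderiv_mul volume hUo.measurableSet hTd hinj]
  refine setLIntegral_congr_fun hUo.measurableSet fun y hy => ?_
  rw [jac_chart g η hy.1 hy.2, ← mul_assoc, ← ENNReal.ofReal_mul (abs_nonneg _), mul_comm |_|]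
  simp only [hT]
  rw [(chartAt (Model n) c').left_inv hy.2]

/-- `η^* μ = Jac_μ(η) μ`, tested in the chart at `c'`. -/
theorem lintegral_diffeo_of_support (g : RMetric n M) (η : M ≃ₘ^∞⟮𝓡 n, 𝓡 n⟯ M) (c' : M)
    {h : M → ENNReal} (hh : Measurable h)
    (hsupp : ∀ x ∉ (chartAt (Model n) c').source, h x = 0) :
    ∫⁻ x, ENNReal.ofReal (jac g η x) * h (η x) ∂(vol g) =
      ∫⁻ z in (chartAt (Model n) c').target,
        ENNReal.ofReal (sqrtDet g c' z) * h ((chartAt (Model n) c').symm z) := by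
  have hopen : ∀ c : M, IsOpen ((chartAt (Model n) c).target ∩
      (chartAt (Model n) c).symm ⁻¹' (η ⁻¹' (chartAt (Model n) c').source)) := fun c =>
    (chartAt (Model n) c).continuousOn_symm.isOpen_inter_preimage
      (chartAt (Model n) c).open_target
      ((chartAt (Model n) c').open_source.preimage η.contMDiff.continuous)
  have hopen' : ∀ c : M, IsOpen ((chartAt (Model n) c').target ∩
      (chartAt (Model n) c').symm ⁻¹' (η.symm ⁻¹' (chartAt (Model n) c).source)) := fun c =>
    (chartAt (Model n) c').continuousOn_symm.isOpen_inter_preimage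
      (chartAt (Model n) c').open_target
      ((chartAt (Model n) c).open_source.preimage η.symm.contMDiff.continuous)
  have hη : Measurable η := η.contMDiff.continuous.measurable
  refine (lintegral_vol g
    ((jac_contMDiff g η).continuous.measurable.ennreal_ofReal.mul (hh.comp hη))).trans ?_
  simp only [Pi.mul_apply, Function.comp_apply]
  -- Both integrals are cut down to the overlap of the two charts before changing variables: on the
  -- source side `h ∘ η` vanishes elsewhere, on the target side the partition function does.
  have key : ∀ c ∈ chartIndices n M, ∫⁻ y in (chartAt (Model n) c).target,
      ENNReal.ofReal (chartPartition n M c ((chartAt (Model n) c).symm y) * sqrtDet g c y) *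
        (ENNReal.ofReal (jac g η ((chartAt (Model n) c).symm y)) *
          h (η ((chartAt (Model n) c).symm y))) =
      ∫⁻ z in (chartAt (Model n) c').target,
        ENNReal.ofReal (chartPartition n M c (η.symm ((chartAt (Model n) c').symm z))) *
          (ENNReal.ofReal (sqrtDet g c' z) * h ((chartAt (Model n) c').symm z)) := by
    intro c _
    have h1 := lintegral_chart_diffeo g η c c'
      (fun x => ENNReal.ofReal (chartPartition n M c (η.symm x)) * h x)
    rw [setLIntegral_eq_of_support inter_subset_left (chartAt (Model n) c).open_target.measurableSet
      (hopen c).measurableSet, setLIntegral_eq_of_support (s := (chartAt (Model n) c').target)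
      inter_subset_left (chartAt (Model n) c').open_target.measurableSet (hopen' c).measurableSet]
    · refine Eq.trans ?_ (h1.trans ?_)
      · refine setLIntegral_congr_fun (hopen c).measurableSet fun y hy => ?_
        simp only [η.symm_apply_apply]
        rw [ENNReal.ofReal_mul (chartPartition_nonneg _ _), ENNReal.ofReal_mul (jac_pos g η _).le]
        ring
      · refine lintegral_congr fun y => ?_
        ring
    · intro z hz hz2
      have h0 : chartPartition n M c (η.symm ((chartAt (Model n) c').symm z)) = 0 := by
        by_contra h0
        exact hz2 ⟨hz, tsupport_chartPartition_subset c (subset_tsupport _ h0)⟩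
      simp [h0]
    · intro y hy hy2
      have h0 : h (η ((chartAt (Model n) c).symm y)) = 0 := hsupp _ fun h0 => hy2 ⟨hy, h0⟩
      simp [h0]
  rw [Finset.sum_congr rfl key, ← lintegral_finsetSum']
  · refine lintegral_congr fun z => ?_
    rw [← Finset.sum_mul, ← ENNReal.ofReal_sum_of_nonneg fun c _ => chartPartition_nonneg _ _,
      sum_chartPartition, ENNReal.ofReal_one, one_mul]
  · intro c _
    have hms := (chartAt (Model n) c').open_target.measurableSet
    refine AEMeasurable.mul ?_ (AEMeasurable.mul ?_ ?_)
    · exact (((chartPartition_contMDiff c).continuous.comp η.symm.contMDiff.continuous).comp_continuousOn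
        (chartAt (Model n) c').continuousOn_symm).aemeasurable hms |>.ennreal_ofReal
    · exact ((sqrtDet_contDiffOn g c').continuousOn.aemeasurable hms).ennreal_ofReal
    · exact hh.comp_aemeasurable (aemeasurable_chart_symm c')

/-- This is the change of variables for the identity. It shows that `vol` is `√det g dy` in every
chart, whatever partition of unity was chosen. -/
theorem lintegral_vol_of_support (g : RMetric n M) (c : M)
    {h : M → ENNReal} (hh : Measurable h)
    (hsupp : ∀ x ∉ (chartAt (Model n) c).source, h x = 0) :
    ∫⁻ x, h x ∂(vol g) = ∫⁻ z in (chartAt (Model n) c).target,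
        ENNReal.ofReal (sqrtDet g c z) * h ((chartAt (Model n) c).symm z) := by
  rw [← lintegral_diffeo_of_support g (Diffeomorph.refl (𝓡 n) M ∞) c hh hsupp]
  simp [jac_refl]

/-- Change of variables: `∫ (h ∘ η) Jac_μ(η) dμ = ∫ h dμ`. -/
theorem lintegral_jac_mul_comp (g : RMetric n M) (η : M ≃ₘ^∞⟮𝓡 n, 𝓡 n⟯ M)
    {h : M → ENNReal} (hh : Measurable h) :
    ∫⁻ x, ENNReal.ofReal (jac g η x) * h (η x) ∂(vol g) = ∫⁻ x, h x ∂(vol g) := by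
  have hη : Measurable η := η.contMDiff.continuous.measurable
  have hm : ∀ c : M, Measurable fun x => ENNReal.ofReal (chartPartition n M c x) * h x := fun c =>
    (chartPartition_contMDiff c).continuous.measurable.ennreal_ofReal.mul hh
  have hz : ∀ c : M, ∀ x ∉ (chartAt (Model n) c).source,
      ENNReal.ofReal (chartPartition n M c x) * h x = 0 := by
    intro c x hx
    have h0 : chartPartition n M c x = 0 := by
      by_contra h0
      exact hx (tsupport_chartPartition_subset c (subset_tsupport _ h0))
    simp [h0]
  have hsum : ∀ x, h x = ∑ c ∈ chartIndices n M, ENNReal.ofReal (chartPartition n M c x) * h x := by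
    intro x
    rw [← Finset.sum_mul, ← ENNReal.ofReal_sum_of_nonneg fun c _ => chartPartition_nonneg _ _,
      sum_chartPartition, ENNReal.ofReal_one, one_mul]
  -- The partition of unity is composed with `η`, so that each piece of `h` is supported in one
  -- target chart; there the formulas for `η` and for the identity have the same right-hand side.
  calc ∫⁻ x, ENNReal.ofReal (jac g η x) * h (η x) ∂(vol g)
      = ∫⁻ x, ∑ c ∈ chartIndices n M, ENNReal.ofReal (jac g η x) *
          (ENNReal.ofReal (chartPartition n M c (η x)) * h (η x)) ∂(vol g) := by
        refine lintegral_congr fun x => ?_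
        rw [← Finset.mul_sum, ← hsum]
    _ = ∑ c ∈ chartIndices n M, ∫⁻ x, ENNReal.ofReal (jac g η x) *
          (ENNReal.ofReal (chartPartition n M c (η x)) * h (η x)) ∂(vol g) :=
        lintegral_finsetSum _ fun c _ =>
          (jac_contMDiff g η).continuous.measurable.ennreal_ofReal.mul ((hm c).comp hη)
    _ = ∑ c ∈ chartIndices n M, ∫⁻ x, ENNReal.ofReal (chartPartition n M c x) * h x ∂(vol g) := by
        refine Finset.sum_congr rfl fun c _ => ?_
        rw [lintegral_diffeo_of_support g η c (hm c) (hz c),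
          ← lintegral_vol_of_support g c (hm c) (hz c)]
    _ = ∫⁻ x, h x ∂(vol g) := by
        rw [← lintegral_finsetSum _ fun c _ => hm c]
        exact lintegral_congr fun x => (hsum x).symm

/-- Each of the finitely many densities is continuous on the chart target and vanishes there outside
a compact subset, the image of the support of the partition function. -/
instance isFiniteMeasure_vol (g : RMetric n M) : IsFiniteMeasure (vol g) := by
  refine ⟨?_⟩
  rw [← lintegral_one, lintegral_vol g measurable_const]
  refine ENNReal.sum_lt_top.2 fun c _ => ?_
  have hK : IsCompact (chartAt (Model n) c '' tsupport (chartPartition n M c)) :=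
    (isClosed_tsupport _).isCompact.image_of_continuousOn
      ((chartAt (Model n) c).continuousOn.mono (tsupport_chartPartition_subset c))
  have hKt : chartAt (Model n) c '' tsupport (chartPartition n M c) ⊆ (chartAt (Model n) c).target := by
    rintro _ ⟨x, hx, rfl⟩
    exact (chartAt (Model n) c).map_source (tsupport_chartPartition_subset c hx)
  rw [setLIntegral_eq_of_support hKt (chartAt (Model n) c).open_target.measurableSet
    hK.measurableSet]
  · have hint := ((continuousOn_density g c).mono hKt).integrableOn_compact hK (μ := volume)
    simpa using hint.lintegral_lt_top
  · intro y hy hyK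
    have h0 : chartPartition n M c ((chartAt (Model n) c).symm y) = 0 := by
      by_contra h0
      exact hyK ⟨_, subset_tsupport _ h0, (chartAt (Model n) c).right_inv hy⟩
    simp [h0]

/-- The density is positive in a chart, so a nonempty open null set would yield a nonempty open
Lebesgue null set. Continuous functions that agree almost everywhere are therefore equal. -/
instance isOpenPosMeasure_vol (g : RMetric n M) : (vol g).IsOpenPosMeasure := by
  refine ⟨fun U hU ⟨x, hx⟩ h0 => ?_⟩
  have hV : IsOpen (U ∩ (chartAt (Model n) x).source) := hU.inter (chartAt (Model n) x).open_source
  have h1 : vol g (U ∩ (chartAt (Model n) x).source) = 0 := measure_mono_null inter_subset_left h0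
  rw [← lintegral_indicator_one hV.measurableSet, lintegral_vol_of_support g x
    (measurable_one.indicator hV.measurableSet)
    (fun y hy => indicator_of_notMem (fun h => hy h.2) _)] at h1
  have hms := (chartAt (Model n) x).open_target.measurableSet
  rw [lintegral_eq_zero_iff' (by
    refine AEMeasurable.mul ((sqrtDet_contDiffOn g x).continuousOn.aemeasurable hms).ennreal_ofReal ?_
    exact (measurable_one.indicator hV.measurableSet).comp_aemeasurable (aemeasurable_chart_symm x))]
    at h1
  have hWo : IsOpen ((chartAt (Model n) x).target ∩ (chartAt (Model n) x).symm ⁻¹' U) :=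
    (chartAt (Model n) x).continuousOn_symm.isOpen_inter_preimage
      (chartAt (Model n) x).open_target hU
  have hW0 : volume ((chartAt (Model n) x).target ∩ (chartAt (Model n) x).symm ⁻¹' U) = 0 := by
    rw [Filter.EventuallyEq, ae_restrict_iff' hms] at h1
    refine measure_mono_null ?_ (ae_iff.1 h1)
    rintro y ⟨hy, hyU⟩ h2
    have h3 := h2 hy
    simp only [Pi.zero_apply] at h3
    rw [indicator_of_mem (show _ ∈ U ∩ _ from ⟨hyU, (chartAt (Model n) x).map_target hy⟩)] at h3
    simp only [Pi.one_apply, mul_one, ENNReal.ofReal_eq_zero] at h3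
    exact absurd h3 (not_le.2 (sqrtDet_pos g hy))
  refine hWo.measure_ne_zero volume ⟨chartAt (Model n) x x, mem_chart_target _ x, ?_⟩ hW0
  simpa using hx

end Volume

/-! ### Differentials of functions and the local divergence -/

section Differential

variable {n : ℕ} {M : Type*} [TopologicalSpace M] [ChartedSpace (Model n) M]

theorem mdifferentiableAt_of_contMDiff {f : M → ℝ} (hf : ContMDiff (𝓡 n) 𝓘(ℝ, ℝ) ∞ f) (x : M) :
    MDifferentiableAt (𝓡 n) 𝓘(ℝ, ℝ) f x := hf.mdifferentiable (by simp) x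

theorem dFun_add {f h : M → ℝ} {x : M} (hf : MDifferentiableAt (𝓡 n) 𝓘(ℝ, ℝ) f x)
    (hh : MDifferentiableAt (𝓡 n) 𝓘(ℝ, ℝ) h x) (v : TangentSpace (𝓡 n) x) :
    dFun (fun x => f x + h x) x v = dFun f x v + dFun h x v :=
  DFunLike.congr_fun (hf.hasMFDerivAt.add hh.hasMFDerivAt).mfderiv v

theorem dFun_mul {f h : M → ℝ} {x : M} (hf : MDifferentiableAt (𝓡 n) 𝓘(ℝ, ℝ) f x)
    (hh : MDifferentiableAt (𝓡 n) 𝓘(ℝ, ℝ) h x) (v : TangentSpace (𝓡 n) x) :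
    dFun (fun x => f x * h x) x v = f x * dFun h x v + h x * dFun f x v :=
  DFunLike.congr_fun (hf.hasMFDerivAt.mul hh.hasMFDerivAt).mfderiv v

theorem dFun_const (r : ℝ) (x : M) (v : TangentSpace (𝓡 n) x) :
    dFun (fun _ : M => r) x v = 0 :=
  DFunLike.congr_fun (mfderiv_const (I := 𝓡 n) (I' := 𝓘(ℝ, ℝ)) (x := x) (c := r)) v

theorem dFun_sum {ι : Type*} (s : Finset ι) {f : ι → M → ℝ}
    (hf : ∀ i, ContMDiff (𝓡 n) 𝓘(ℝ, ℝ) ∞ (f i)) (x : M) (v : TangentSpace (𝓡 n) x) :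
    dFun (fun x => ∑ i ∈ s, f i x) x v = ∑ i ∈ s, dFun (f i) x v := by
  classical
  induction s using Finset.induction_on with
  | empty => simpa using dFun_const 0 x v
  | insert i s hi ih =>
    simp only [Finset.sum_insert hi, ← ih]
    exact dFun_add (mdifferentiableAt_of_contMDiff (hf i) x)
      (mdifferentiableAt_of_contMDiff (contMDiff_finsetSum (fun i _ => hf i)) x) v

variable [IsManifold (𝓡 n) ∞ M]

theorem contMDiffAt_iff_chart' {f : M → ℝ} {c x : M} (hx : x ∈ (chartAt (Model n) c).source) :
    ContMDiffAt (𝓡 n) 𝓘(ℝ, ℝ) ∞ f x ↔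
      ContDiffAt ℝ ∞ (fun y => f ((chartAt (Model n) c).symm y)) (chartAt (Model n) c x) := by
  rw [← contMDiffAt_iff_chart ((chartAt (Model n) c).map_source hx),
    (chartAt (Model n) c).left_inv hx]

theorem contDiffOn_chart_of_contMDiff {f : M → ℝ} (hf : ContMDiff (𝓡 n) 𝓘(ℝ, ℝ) ∞ f) (c : M) :
    ContDiffOn ℝ ∞ (f ∘ (chartAt (Model n) c).symm) (chartAt (Model n) c).target :=
  fun _ hy => ((contMDiffAt_iff_chart hy).1 (hf _)).contDiffWithinAt

theorem dFun_apply_contMDiff {f : M → ℝ} (hf : ContMDiff (𝓡 n) 𝓘(ℝ, ℝ) ∞ f)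
    {u : Π x : M, TangentSpace (𝓡 n) x} (hu : SmoothField u) :
    ContMDiff (𝓡 n) 𝓘(ℝ, ℝ) ∞ (fun x => dFun f x (u x)) := by
  intro x
  refine (contMDiffAt_iff_chart' (mem_chart_source (Model n) x)).2 ?_
  refine ContDiffOn.contDiffAt ?_
    ((chartAt (Model n) x).open_target.mem_nhds (mem_chart_target _ x))
  refine ContDiffOn.congr (f := fun y => ∑ i, comp u x y i *
      partialD i (f ∘ (chartAt (Model n) x).symm) y) ?_
    fun y hy => dFun_apply_eq_sum hy (mdifferentiableAt_of_contMDiff hf _) u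
  exact ContDiffOn.sum fun i _ => (comp_contDiffOn hu x i).mul
    (contDiffOn_fderiv_apply (chartAt (Model n) x).open_target
      (contDiffOn_chart_of_contMDiff hf x) (stdVec i))

/-- The formula for the divergence in the chart at `c`. -/
def localDiv (g : RMetric n M) (u : Π x : M, TangentSpace (𝓡 n) x) (c : M) (y : Model n) : ℝ :=
  (sqrtDet g c y)⁻¹ * ∑ i, partialD i (fun y => sqrtDet g c y * comp u c y i) y

theorem localDiv_contDiffOn (g : RMetric n M) {u : Π x : M, TangentSpace (𝓡 n) x}
    (hu : SmoothField u) (c : M) :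
    ContDiffOn ℝ ∞ (localDiv g u c) (chartAt (Model n) c).target :=
  ((sqrtDet_contDiffOn g c).inv fun _ hy => (sqrtDet_pos g hy).ne').mul
    (ContDiffOn.sum fun i _ => contDiffOn_fderiv_apply (chartAt (Model n) c).open_target
      ((sqrtDet_contDiffOn g c).mul (comp_contDiffOn hu c i)) (stdVec i))

end Differential

/-! ### The divergence theorem and the weak characterisation of the divergence -/

section IntegrationByParts

theorem integral_fderiv_apply_eq_zero {n : ℕ} {P : Model n → ℝ} (hP : ContDiff ℝ ∞ P)
    (hc : HasCompactSupport P) (v : Model n) : ∫ y, fderiv ℝ P y v = 0 := by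
  have hi : Integrable (fun y => fderiv ℝ P y v) :=
    (((hP.fderiv_right (m := ∞) (by simp)).clm_apply contDiff_const).continuous).integrable_of_hasCompactSupport
      (hc.fderiv_apply ℝ v)
  have h := integral_mul_fderiv_eq_neg_fderiv_mul_of_integrable (μ := volume)
    (f := fun _ : Model n => (1 : ℝ)) (g := P) (v := v) (by simp) (by simpa using hi)
    (by simpa using hP.continuous.integrable_of_hasCompactSupport hc)
    (fun _ _ => differentiableAt_const _) (fun x _ => hP.differentiable (by simp) x)
  simpa using h

variable {n : ℕ} {M : Type*} [TopologicalSpace M] [ChartedSpace (Model n) M]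
  [IsManifold (𝓡 n) ∞ M] [CompactSpace M] [T2Space M] [MeasurableSpace M] [BorelSpace M]

theorem integrable_vol (g : RMetric n M) {f : M → ℝ} (hf : Continuous f) :
    Integrable f (vol g) :=
  hf.integrable_of_hasCompactSupport (HasCompactSupport.of_compactSpace f)

/-- The formula for nonnegative functions says that `η` pushes `Jac(η) μ` forward to `μ`; real
integrands follow from this equality of measures. -/
theorem integral_jac_mul_comp (g : RMetric n M) (η : M ≃ₘ^∞⟮𝓡 n, 𝓡 n⟯ M) {h : M → ℝ}
    (hh : Continuous h) : ∫ x, jac g η x * h (η x) ∂(vol g) = ∫ x, h x ∂(vol g) := by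
  have hη : Measurable η := η.contMDiff.continuous.measurable
  have hj : Measurable fun x => ENNReal.ofReal (jac g η x) :=
    (jac_contMDiff g η).continuous.measurable.ennreal_ofReal
  have hm : ((vol g).withDensity fun x => ENNReal.ofReal (jac g η x)).map η = vol g := by
    refine Measure.ext_of_lintegral _ fun f hf => ?_
    rw [lintegral_map hf hη]
    exact (lintegral_withDensity_eq_lintegral_mul _ hj (hf.comp hη)).trans
      (lintegral_jac_mul_comp g η hf)
  conv_rhs => rw [← hm, integral_map hη.aemeasurable hh.aestronglyMeasurable,
    integral_withDensity_eq_integral_toReal_smul hj (by simp)]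
  simp [ENNReal.toReal_ofReal (jac_pos g η _).le]

theorem integral_vol_of_support (g : RMetric n M) (c : M) {h : M → ℝ} (hh : Continuous h)
    (hsupp : ∀ x ∉ (chartAt (Model n) c).source, h x = 0) :
    ∫ x, h x ∂(vol g) =
      ∫ y in (chartAt (Model n) c).target, sqrtDet g c y * h ((chartAt (Model n) c).symm y) := by
  have hms := (chartAt (Model n) c).open_target.measurableSet
  have hss := (chartAt (Model n) c).open_source.measurableSet
  have hj : AEMeasurable (fun y => ENNReal.ofReal (sqrtDet g c y))
      ((volume : Measure (Model n)).restrict (chartAt (Model n) c).target) :=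
    ((sqrtDet_contDiffOn g c).continuousOn.aemeasurable hms).ennreal_ofReal
  have hac := withDensity_absolutelyContinuous
    ((volume : Measure (Model n)).restrict (chartAt (Model n) c).target)
    (fun y => ENNReal.ofReal (sqrtDet g c y))
  have hm : (((volume : Measure (Model n)).restrict (chartAt (Model n) c).target).withDensity
      fun y => ENNReal.ofReal (sqrtDet g c y)).map (chartAt (Model n) c).symm =
      (vol g).restrict (chartAt (Model n) c).source := by
    refine Measure.ext_of_lintegral _ fun f hf => ?_
    rw [lintegral_map' hf.aemeasurable ((aemeasurable_chart_symm c).mono_ac hac),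
      ← lintegral_indicator hss, lintegral_vol_of_support g c (hf.indicator hss)
        (fun x hx => indicator_of_notMem hx _)]
    refine (lintegral_withDensity_eq_lintegral_mul₀ hj
      (hf.comp_aemeasurable (aemeasurable_chart_symm c))).trans ?_
    refine setLIntegral_congr_fun hms fun y hy => ?_
    simp only [Pi.mul_apply, Function.comp_apply]
    rw [indicator_of_mem ((chartAt (Model n) c).map_target hy)]
  rw [← setIntegral_eq_integral_of_forall_compl_eq_zero hsupp, ← hm,
    integral_map ((aemeasurable_chart_symm c).mono_ac hac) hh.aestronglyMeasurable,
    integral_withDensity_eq_integral_toReal_smul₀ hj (by simp)]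
  refine setIntegral_congr_fun hms fun y hy => ?_
  simp [ENNReal.toReal_ofReal (sqrtDet_pos g hy).le]

omit [IsManifold (𝓡 n) ∞ M] [CompactSpace M] [T2Space M] [MeasurableSpace M] [BorelSpace M] in
theorem continuous_mul_comp_chart {h : M → ℝ} (hh : Continuous h) {c : M}
    (hsupp : tsupport h ⊆ (chartAt (Model n) c).source) {F : Model n → ℝ}
    (hF : ContinuousOn F (chartAt (Model n) c).target) :
    Continuous fun x => h x * F (chartAt (Model n) c x) := by
  refine continuous_of_tsupport fun x hx => ?_
  have hx' := hsupp (tsupport_mul_subset_left hx)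
  refine hh.continuousAt.mul (ContinuousAt.comp (g := F) ?_ ?_)
  · exact hF.continuousAt ((chartAt (Model n) c).open_target.mem_nhds
      ((chartAt (Model n) c).map_source hx'))
  · exact (chartAt (Model n) c).continuousAt hx'

omit [IsManifold (𝓡 n) ∞ M] [CompactSpace M] [T2Space M] [MeasurableSpace M] [BorelSpace M] in
theorem dFun_eq_zero_of_notMem_tsupport {h : M → ℝ} {x : M} (hx : x ∉ tsupport h)
    (v : TangentSpace (𝓡 n) x) : dFun h x v = 0 := by
  have h1 : h =ᶠ[𝓝 x] fun _ => 0 := notMem_tsupport_iff_eventuallyEq.1 hx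
  exact (DFunLike.congr_fun (h1.mfderiv_eq (I := 𝓡 n) (I' := 𝓘(ℝ, ℝ))) v).trans (dFun_const 0 x v)

/-- The divergence theorem in a chart. -/
theorem integral_mul_localDiv (g : RMetric n M) {u : Π x : M, TangentSpace (𝓡 n) x}
    (hu : SmoothField u) {h : M → ℝ} (hh : ContMDiff (𝓡 n) 𝓘(ℝ, ℝ) ∞ h) {c : M}
    (hsupp : tsupport h ⊆ (chartAt (Model n) c).source) :
    ∫ x, h x * localDiv g u c (chartAt (Model n) c x) ∂(vol g) =
      -∫ x, dFun h x (u x) ∂(vol g) := by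
  have hms := (chartAt (Model n) c).open_target.measurableSet
  have hc1 : Continuous fun x => h x * localDiv g u c (chartAt (Model n) c x) :=
    continuous_mul_comp_chart hh.continuous hsupp (localDiv_contDiffOn g hu c).continuousOn
  have hc2 : Continuous fun x => dFun h x (u x) := (dFun_apply_contMDiff hh hu).continuous
  rw [eq_neg_iff_add_eq_zero, ← integral_add (integrable_vol g hc1) (integrable_vol g hc2),
    integral_vol_of_support g c (h := fun x => h x * localDiv g u c (chartAt (Model n) c x) +
      dFun h x (u x)) (hc1.add hc2)]
  swap
  · intro x hx
    have h1 : h x = 0 := by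
      by_contra h0
      exact hx (hsupp (subset_tsupport _ h0))
    rw [h1, dFun_eq_zero_of_notMem_tsupport fun h0 => hx (hsupp h0)]
    simp
  set H := h ∘ (chartAt (Model n) c).symm with hH
  have hHc : ContDiffOn ℝ ∞ H (chartAt (Model n) c).target := contDiffOn_chart_of_contMDiff hh c
  have hUc : ∀ i, ContDiffOn ℝ ∞ (fun y => sqrtDet g c y * comp u c y i)
      (chartAt (Model n) c).target := fun i => (sqrtDet_contDiffOn g c).mul (comp_contDiffOn hu c i)
  -- Extended by zero, `h √det g uⁱ` is smooth with compact support on all of `ℝⁿ`. On the chart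
  -- target `∑ ∂ᵢ Pᵢ` is `√det g` times the integrand, so its integral vanishes.
  let P : Fin n → Model n → ℝ := fun i => (chartAt (Model n) c).target.indicator
    fun y => H y * (sqrtDet g c y * comp u c y i)
  have hK : IsCompact (chartAt (Model n) c '' tsupport h) :=
    (isClosed_tsupport _).isCompact.image_of_continuousOn
      ((chartAt (Model n) c).continuousOn.mono hsupp)
  have hPK : ∀ i, ∀ y ∉ chartAt (Model n) c '' tsupport h, P i y = 0 := by
    intro i y hy
    by_cases hyt : y ∈ (chartAt (Model n) c).target
    · have h1 : H y = 0 := by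
        by_contra h0
        exact hy ⟨_, subset_tsupport _ h0, (chartAt (Model n) c).right_inv hyt⟩
      simp [P, h1]
    · exact indicator_of_notMem hyt _
  have hPeq : ∀ i, ∀ y ∈ (chartAt (Model n) c).target,
      P i =ᶠ[𝓝 y] fun y => H y * (sqrtDet g c y * comp u c y i) := by
    intro i y hy
    filter_upwards [(chartAt (Model n) c).open_target.mem_nhds hy] with z hz
    exact indicator_of_mem hz _
  have hPs : ∀ i, ContDiff ℝ ∞ (P i) := by
    intro i
    refine contDiff_iff_contDiffAt.2 fun y => ?_
    by_cases hyt : y ∈ (chartAt (Model n) c).target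
    · exact ((hHc.mul (hUc i)).contDiffAt
        ((chartAt (Model n) c).open_target.mem_nhds hyt)).congr_of_eventuallyEq (hPeq i y hyt)
    · have hyK : y ∉ chartAt (Model n) c '' tsupport h := by
        rintro ⟨x, hx, rfl⟩
        exact hyt ((chartAt (Model n) c).map_source (hsupp hx))
      refine (contDiffAt_const (c := (0 : ℝ))).congr_of_eventuallyEq ?_
      filter_upwards [hK.isClosed.isOpen_compl.mem_nhds hyK] with z hz using hPK i z hz
  have hPc : ∀ i, HasCompactSupport (P i) := fun i => HasCompactSupport.intro hK (hPK i)
  have hint : ∀ i, Integrable (fun y => fderiv ℝ (P i) y (stdVec i)) := fun i =>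
    ((((hPs i).fderiv_right (m := ∞) (by simp)).clm_apply
      contDiff_const).continuous).integrable_of_hasCompactSupport ((hPc i).fderiv_apply ℝ _)
  have hzero : ∫ y, ∑ i, fderiv ℝ (P i) y (stdVec i) = 0 := by
    rw [integral_finsetSum _ fun i _ => hint i]
    exact Finset.sum_eq_zero fun i _ => integral_fderiv_apply_eq_zero (hPs i) (hPc i) _
  rw [← setIntegral_eq_integral_of_forall_compl_eq_zero (s := (chartAt (Model n) c).target)] at hzero
  · rw [← hzero]
    refine setIntegral_congr_fun hms fun y hy => ?_
    have hnh := (chartAt (Model n) c).open_target.mem_nhds hy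
    have hd : ∀ i, fderiv ℝ (P i) y (stdVec i) =
        H y * partialD i (fun y => sqrtDet g c y * comp u c y i) y +
          sqrtDet g c y * comp u c y i * partialD i H y := by
      intro i
      rw [(hPeq i y hy).fderiv_eq, fderiv_fun_mul ((hHc.contDiffAt hnh).differentiableAt (by simp))
        (((hUc i).contDiffAt hnh).differentiableAt (by simp))]
      rfl
    simp only [hd, (chartAt (Model n) c).right_inv hy]
    rw [dFun_apply_eq_sum hy (mdifferentiableAt_of_contMDiff hh _) u, Finset.sum_add_distrib, mul_add,
      localDiv]
    congr 1
    · have := (sqrtDet_pos g hy).ne'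
      rw [← Finset.mul_sum]
      simp only [hH, Function.comp_apply]
      field_simp
    · rw [Finset.mul_sum]
      exact Finset.sum_congr rfl fun i _ => by rw [mul_assoc]
  · intro y hy
    refine Finset.sum_eq_zero fun i _ => ?_
    have hyK : y ∉ chartAt (Model n) c '' tsupport h := by
      rintro ⟨x, hx, rfl⟩
      exact hy ((chartAt (Model n) c).map_source (hsupp hx))
    have h1 : P i =ᶠ[𝓝 y] fun _ => 0 := by
      filter_upwards [hK.isClosed.isOpen_compl.mem_nhds hyK] with z hz using hPK i z hz
    rw [h1.fderiv_eq]
    simp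

/-- The formula for the divergence does not depend on the chart. -/
theorem divg_eq_localDiv (g : RMetric n M) {u : Π x : M, TangentSpace (𝓡 n) x}
    (hu : SmoothField u) {c x : M} (hx : x ∈ (chartAt (Model n) c).source) :
    divg g u x = localDiv g u c (chartAt (Model n) c x) := by
  set W := (chartAt (Model n) c).source ∩ (chartAt (Model n) x).source with hW
  have hWo : IsOpen W := (chartAt (Model n) c).open_source.inter (chartAt (Model n) x).open_source
  have hcont : ∀ c' : M, W ⊆ (chartAt (Model n) c').source →
      ContinuousOn (fun z => localDiv g u c' (chartAt (Model n) c' z)) W := fun c' hc' =>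
    (localDiv_contDiffOn g hu c').continuousOn.comp ((chartAt (Model n) c').continuousOn.mono hc')
      fun z hz => (chartAt (Model n) c').map_source (hc' hz)
  have h1 := hcont c inter_subset_left
  have h2 := hcont x inter_subset_right
  have hae : ∀ᵐ z ∂(vol g), z ∈ W → localDiv g u x (chartAt (Model n) x z) -
      localDiv g u c (chartAt (Model n) c z) = 0 := by
    -- Against a test function supported in the overlap, both local formulas integrate to `-∫ dh(u)
    -- dμ`, which mentions no chart.
    refine hWo.ae_eq_zero_of_integral_contMDiff_smul_eq_zero (𝓡 n)
      ((h2.sub h1).locallyIntegrableOn hWo.measurableSet) fun h hh _ hs => ?_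
    simp only [smul_eq_mul, mul_sub]
    have hsc := hs.trans inter_subset_left
    have hsx := hs.trans inter_subset_right
    rw [integral_sub (integrable_vol g (continuous_mul_comp_chart hh.continuous hsx
      (localDiv_contDiffOn g hu x).continuousOn)) (integrable_vol g (continuous_mul_comp_chart
      hh.continuous hsc (localDiv_contDiffOn g hu c).continuousOn)),
      integral_mul_localDiv g hu hh hsc, integral_mul_localDiv g hu hh hsx, sub_self]
  have hae2 : (fun z => localDiv g u x (chartAt (Model n) x z)) =ᵐ[(vol g).restrict W]
      fun z => localDiv g u c (chartAt (Model n) c z) := by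
    rw [Filter.EventuallyEq, ae_restrict_iff' hWo.measurableSet]
    filter_upwards [hae] with z hz hzW using sub_eq_zero.1 (hz hzW)
  exact Measure.eqOn_open_of_ae_eq hae2 hWo h2 h1 ⟨hx, mem_chart_source _ x⟩

/-- The definition of `divg` uses a different chart at each point, so smoothness requires chart
independence: near `x` all values come from the single chart at `x`. -/
theorem divg_contMDiff (g : RMetric n M) {u : Π x : M, TangentSpace (𝓡 n) x}
    (hu : SmoothField u) : ContMDiff (𝓡 n) 𝓘(ℝ, ℝ) ∞ (divg g u) := by
  intro x
  refine (contMDiffAt_iff_chart' (mem_chart_source (Model n) x)).2 ?_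
  refine ((localDiv_contDiffOn g hu x).congr fun y hy => ?_).contDiffAt
    ((chartAt (Model n) x).open_target.mem_nhds (mem_chart_target _ x))
  rw [divg_eq_localDiv g hu ((chartAt (Model n) x).map_target hy), (chartAt (Model n) x).right_inv hy]

/-- The divergence theorem: `∫ h div u dμ = -∫ dh(u) dμ`. -/
theorem integral_mul_divg (g : RMetric n M) {u : Π x : M, TangentSpace (𝓡 n) x}
    (hu : SmoothField u) {h : M → ℝ} (hh : ContMDiff (𝓡 n) 𝓘(ℝ, ℝ) ∞ h) :
    ∫ x, h x * divg g u x ∂(vol g) = -∫ x, dFun h x (u x) ∂(vol g) := by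
  have hs : ∀ c, ContMDiff (𝓡 n) 𝓘(ℝ, ℝ) ∞ (fun x => chartPartition n M c x * h x) := fun c =>
    (chartPartition_contMDiff c).mul hh
  have hsum : ∀ x, h x = ∑ c ∈ chartIndices n M, chartPartition n M c x * h x := fun x => by
    rw [← Finset.sum_mul, sum_chartPartition, one_mul]
  have hts : ∀ c, tsupport (fun x => chartPartition n M c x * h x) ⊆ (chartAt (Model n) c).source :=
    fun c => tsupport_mul_subset_left.trans (tsupport_chartPartition_subset c)
  have hd : ∀ x, dFun h x (u x) =
      ∑ c ∈ chartIndices n M, dFun (fun x => chartPartition n M c x * h x) x (u x) := fun x => by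
    rw [← dFun_sum _ hs]
    congr 1
    exact congrArg (fun f => dFun f x) (funext hsum)
  simp only [hd]
  rw [integral_finsetSum _ fun c _ => integrable_vol g (dFun_apply_contMDiff (hs c) hu).continuous,
    ← Finset.sum_neg_distrib]
  have e : (fun x => h x * divg g u x) = fun x => ∑ c ∈ chartIndices n M,
      chartPartition n M c x * h x * localDiv g u c (chartAt (Model n) c x) := by
    funext x
    conv_lhs => rw [hsum x, Finset.sum_mul]
    refine Finset.sum_congr rfl fun c _ => ?_
    by_cases hx : x ∈ (chartAt (Model n) c).source
    · rw [divg_eq_localDiv g hu hx]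
    · have h0 : chartPartition n M c x = 0 := by
        by_contra h0
        exact hx (tsupport_chartPartition_subset c (subset_tsupport _ h0))
      simp [h0]
  rw [e, integral_finsetSum _ fun c _ => integrable_vol g
    (continuous_mul_comp_chart (hs c).continuous (hts c) (localDiv_contDiffOn g hu c).continuousOn)]
  exact Finset.sum_congr rfl fun c _ => integral_mul_localDiv g hu (hs c) (hts c)

theorem integral_divg (g : RMetric n M) {u : Π x : M, TangentSpace (𝓡 n) x}
    (hu : SmoothField u) : ∫ x, divg g u x ∂(vol g) = 0 := by
  have h := integral_mul_divg g hu (contMDiff_const (c := (1 : ℝ)))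
  simpa [dFun_const] using h

/-- The fundamental lemma of the calculus of variations. -/
theorem eq_of_forall_integral_mul_eq (g : RMetric n M) {F F' : M → ℝ} (hF : Continuous F)
    (hF' : Continuous F') (h : ∀ k : M → ℝ, ContMDiff (𝓡 n) 𝓘(ℝ, ℝ) ∞ k →
      ∫ x, k x * F x ∂(vol g) = ∫ x, k x * F' x ∂(vol g)) : F = F' := by
  have hae := ae_eq_zero_of_integral_contMDiff_smul_eq_zero (𝓡 n) (μ := vol g)
    (f := fun x => F x - F' x) (integrable_vol g (hF.sub hF')).locallyIntegrable fun k hk _ => by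
      simp only [smul_eq_mul, mul_sub]
      rw [integral_sub (integrable_vol g (f := fun x => k x * F x) (hk.continuous.mul hF))
        (integrable_vol g (f := fun x => k x * F' x) (hk.continuous.mul hF')), h k hk, sub_self]
  refine Continuous.ae_eq_iff_eq (vol g) hF hF' |>.1 ?_
  filter_upwards [hae] with x hx using sub_eq_zero.1 hx

end IntegrationByParts

/-! ### Vector fields in charts, Lie brackets and locally constant functions -/

section Fields

variable {n : ℕ} {M : Type*} [TopologicalSpace M] [ChartedSpace (Model n) M]

/-- The vector field `u` read in the chart at `c`. -/
def chartField (u : Π x : M, TangentSpace (𝓡 n) x) (c : M) (y : Model n) : Model n :=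
  dchart c ((chartAt (Model n) c).symm y) (u ((chartAt (Model n) c).symm y))

variable [IsManifold (𝓡 n) ∞ M]

theorem chartField_contDiffOn {u : Π x : M, TangentSpace (𝓡 n) x} (hu : SmoothField u) (c : M) :
    ContDiffOn ℝ ∞ (chartField u c) (chartAt (Model n) c).target :=
  contDiffOn_euclidean.2 fun i => comp_contDiffOn hu c i

theorem smoothField_of_chartField {u : Π x : M, TangentSpace (𝓡 n) x}
    (hu : ∀ c : M, ContDiffOn ℝ ∞ (chartField u c) (chartAt (Model n) c).target) :
    SmoothField u := by
  intro x
  have h : ContMDiffOn (𝓡 n) (𝓡 n).tangent ∞ (fun x => (⟨x, u x⟩ : TangentBundle (𝓡 n) M))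
      (chartAt (Model n) x).source := by
    refine (contMDiffOn_iff_dchart (𝓡 n) (p := id) (mapsTo_id _)).2 ⟨contMDiffOn_id, ?_⟩
    have h1 : ContMDiffOn (𝓡 n) 𝓘(ℝ, Model n) ∞ (chartField u x ∘ chartAt (Model n) x)
        (chartAt (Model n) x).source :=
      (contMDiffOn_iff_contDiffOn.2 (hu x)).comp contMDiffOn_chart
        fun y hy => (chartAt (Model n) x).map_source hy
    refine h1.congr fun y hy => ?_
    simp only [Function.comp_apply, chartField]
    rw [(chartAt (Model n) x).left_inv hy]
    rfl
  exact h.contMDiffAt ((chartAt (Model n) x).open_source.mem_nhds (mem_chart_source _ x))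

theorem dFun_chart' {f : M → ℝ} {c x : M} (hx : x ∈ (chartAt (Model n) c).source)
    (hf : MDifferentiableAt (𝓡 n) 𝓘(ℝ, ℝ) f x) (v : TangentSpace (𝓡 n) x) :
    dFun f x v = fderiv ℝ (f ∘ (chartAt (Model n) c).symm) (chartAt (Model n) c x)
      (dchart c x v) := by
  obtain ⟨y, hy, rfl⟩ : ∃ y ∈ (chartAt (Model n) c).target, (chartAt (Model n) c).symm y = x :=
    ⟨_, (chartAt (Model n) c).map_source hx, (chartAt (Model n) c).left_inv hx⟩
  rw [(chartAt (Model n) c).right_inv hy]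
  exact dFun_chart hy hf v

theorem dchart_self (x : M) (v : TangentSpace (𝓡 n) x) : dchart x x v = v := by
  have : IsManifold (𝓡 n) 1 M := .of_le (n := ∞) (by exact_mod_cast le_top)
  exact DFunLike.congr_fun (mfderiv_extChartAt_self (I := 𝓡 n) (x := x)) v

theorem mlieBracket_eq_lieBracket (w u : Π x : M, TangentSpace (𝓡 n) x) (x : M) :
    dchart x x (VectorField.mlieBracket (𝓡 n) w u x) =
      VectorField.lieBracket ℝ (chartField w x) (chartField u x) (chartAt (Model n) x x) := by
  have : IsManifold (𝓡 n) 1 M := .of_le (n := ∞) (by exact_mod_cast le_top)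
  -- The bracket on `M` is defined through pullbacks by the inverse chart; near the base point these
  -- are the fields read in the chart.
  have hpull : ∀ v : Π x : M, TangentSpace (𝓡 n) x,
      (VectorField.mpullbackWithin 𝓘(ℝ, Model n) (𝓡 n) (extChartAt (𝓡 n) x).symm v
        (range (𝓡 n)) : Model n → Model n) =ᶠ[𝓝 (chartAt (Model n) x x)] chartField v x := by
    intro v
    filter_upwards [(chartAt (Model n) x).open_target.mem_nhds (mem_chart_target _ x)] with y hy
    have hy' : y ∈ (extChartAt (𝓡 n) x).target := by simpa using hy
    have h1 := mfderivWithin_extChartAt_symm_comp_mfderiv_extChartAt (I := 𝓡 n) hy'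
    have h2 := mfderiv_extChartAt_comp_mfderivWithin_extChartAt_symm (I := 𝓡 n) hy'
    have h3 := ContinuousLinearMap.inverse_eq h1 h2
    exact DFunLike.congr_fun h3 _
  rw [dchart_self, ← VectorField.mlieBracketWithin_univ, VectorField.mlieBracketWithin_apply,
    mfderiv_extChartAt_self]
  refine (DFunLike.congr_fun (ContinuousLinearMap.inverse_id (R := ℝ) (M := Model n)) _).trans ?_
  have hset : ((extChartAt (𝓡 n) x).symm ⁻¹' univ ∩ range (𝓡 n)) = univ := by simp
  rw [hset]
  refine (congrFun (VectorField.lieBracketWithin_univ (𝕜 := ℝ)) _).trans ?_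
  exact Filter.EventuallyEq.lieBracket_vectorField_eq (hpull w) (hpull u)

/-- In a chart each iterated derivative is a Hessian term plus a term differentiating the field. The
Hessian terms cancel by symmetry and the rest is the differential applied to the coordinate bracket.
-/
theorem dFun_mlieBracket {h : M → ℝ} (hh : ContMDiff (𝓡 n) 𝓘(ℝ, ℝ) ∞ h)
    {w u : Π x : M, TangentSpace (𝓡 n) x} (hw : SmoothField w) (hu : SmoothField u) (x : M) :
    dFun h x (VectorField.mlieBracket (𝓡 n) w u x) =
      dFun (fun y => dFun h y (u y)) x (w x) - dFun (fun y => dFun h y (w y)) x (u x) := by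
  have hx := mem_chart_source (Model n) x
  have hnh := (chartAt (Model n) x).open_target.mem_nhds (mem_chart_target (Model n) x)
  set H := h ∘ (chartAt (Model n) x).symm with hH
  have hHc : ContDiffOn ℝ ∞ H (chartAt (Model n) x).target := contDiffOn_chart_of_contMDiff hh x
  have hHd : DifferentiableAt ℝ (fderiv ℝ H) (chartAt (Model n) x x) :=
    ((hHc.fderiv_of_isOpen (chartAt (Model n) x).open_target (m := ∞) (by simp)).contDiffAt
      hnh).differentiableAt (by simp)
  have hsymm : IsSymmSndFDerivAt ℝ H (chartAt (Model n) x x) :=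
    (hHc.contDiffAt hnh).isSymmSndFDerivAt
      (by simpa using (WithTop.coe_le_coe.2 le_top : ((2 : ℕ∞) : WithTop ℕ∞) ≤ ∞))
  have hd : ∀ v : Π x : M, TangentSpace (𝓡 n) x, SmoothField v →
      DifferentiableAt ℝ (chartField v x) (chartAt (Model n) x x) := fun v hv =>
    ((chartField_contDiffOn hv x).contDiffAt hnh).differentiableAt (by simp)
  have hval : ∀ v : Π x : M, TangentSpace (𝓡 n) x,
      dchart x x (v x) = chartField v x (chartAt (Model n) x x) := by
    intro v
    simp only [chartField]
    rw [(chartAt (Model n) x).left_inv hx]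
  have key : ∀ v v' : Π x : M, TangentSpace (𝓡 n) x, SmoothField v →
      dFun (fun y => dFun h y (v y)) x (v' x) =
        fderiv ℝ (fderiv ℝ H) (chartAt (Model n) x x) (chartField v' x (chartAt (Model n) x x))
          (chartField v x (chartAt (Model n) x x)) +
        fderiv ℝ H (chartAt (Model n) x x) (fderiv ℝ (chartField v x) (chartAt (Model n) x x)
          (chartField v' x (chartAt (Model n) x x))) := by
    intro v v' hv
    rw [dFun_chart' hx (mdifferentiableAt_of_contMDiff (dFun_apply_contMDiff hh hv) x), hval]
    have e : (fun y => dFun h y (v y)) ∘ (chartAt (Model n) x).symm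
        =ᶠ[𝓝 (chartAt (Model n) x x)] fun y => fderiv ℝ H y (chartField v x y) := by
      filter_upwards [hnh] with y hy using dFun_chart hy (mdifferentiableAt_of_contMDiff hh _) _
    rw [e.fderiv_eq, fderiv_clm_apply hHd (hd v hv)]
    simp [add_comm]
  rw [key u w hu, key w u hw, dFun_chart' hx (mdifferentiableAt_of_contMDiff hh x),
    mlieBracket_eq_lieBracket, VectorField.lieBracket, map_sub]
  have := hsymm (chartField u x (chartAt (Model n) x x)) (chartField w x (chartAt (Model n) x x))
  rw [this]
  ring

theorem smoothField_mlieBracket {w u : Π x : M, TangentSpace (𝓡 n) x} (hw : SmoothField w)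
    (hu : SmoothField u) : SmoothField (VectorField.mlieBracket (𝓡 n) w u) := by
  have : IsManifold (𝓡 n) (((⊤ : ℕ∞) : WithTop ℕ∞) + 1) M := by simpa
  have : IsManifold (𝓡 n) (minSmoothness ℝ 2) M := .of_le (n := ∞)
    (by simpa using (WithTop.coe_le_coe.2 le_top : ((2 : ℕ∞) : WithTop ℕ∞) ≤ ∞))
  exact ContDiff.mlieBracket_vectorField (m := ⊤) (n := ⊤) hw hu (by simp)

theorem SmoothField.neg {u : Π x : M, TangentSpace (𝓡 n) x} (hu : SmoothField u) :
    SmoothField (fun x => -u x) := ContMDiff.neg_section hu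

theorem SmoothField.add {u v : Π x : M, TangentSpace (𝓡 n) x} (hu : SmoothField u)
    (hv : SmoothField v) : SmoothField (fun x => u x + v x) := ContMDiff.add_section hu hv

/-- A smooth function with vanishing differential is constant. -/
theorem exists_eq_const_of_dFun_eq_zero [ConnectedSpace M] {f : M → ℝ}
    (hf : ContMDiff (𝓡 n) 𝓘(ℝ, ℝ) ∞ f) (h : ∀ x v, dFun (n := n) f x v = 0) :
    ∃ r, ∀ x, f x = r := by
  have hlc : IsLocallyConstant f := by
    refine (IsLocallyConstant.iff_eventually_eq f).2 fun x => ?_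
    obtain ⟨ε, hε, hball⟩ := Metric.isOpen_iff.1 (chartAt (Model n) x).open_target _
      (mem_chart_target (Model n) x)
    have hc := contDiffOn_chart_of_contMDiff hf x
    obtain ⟨a, ha⟩ := Metric.isOpen_ball.exists_is_const_of_fderiv_eq_zero
      (convex_ball (chartAt (Model n) x x) ε).isPreconnected
      ((hc.mono hball).differentiableOn (by simp)) (fun y hy => by
        ext v
        have hy' := hball hy
        -- Every direction `v` of the model is the image under the chart of a tangent vector of `M`.
        have h1 := dFun_chart hy' (mdifferentiableAt_of_contMDiff hf _) (∑ i, v i • coordVec x y i)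
        rw [h] at h1
        simp only [map_sum, map_smul, dchart_coordVec hy', sum_apply_smul_stdVec] at h1
        simpa [← map_smul, ← map_sum, sum_apply_smul_stdVec] using h1.symm)
    filter_upwards [(chartAt (Model n) x).open_source.mem_nhds (mem_chart_source _ x),
      ((chartAt (Model n) x).continuousAt (mem_chart_source _ x)).preimage_mem_nhds
        (Metric.ball_mem_nhds _ hε)] with z hzs hzb
    have h1 := ha _ hzb
    have h2 := ha _ (Metric.mem_ball_self hε)
    simp only [Function.comp_apply] at h1 h2
    rw [(chartAt (Model n) x).left_inv hzs] at h1
    rw [(chartAt (Model n) x).left_inv (mem_chart_source _ x)] at h2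
    rw [h1, h2]
  obtain ⟨x₀⟩ := (inferInstance : Nonempty M)
  exact ⟨f x₀, fun x => hlc.apply_eq_of_preconnectedSpace x x₀⟩

/-- The extension has constant coefficients in the trivialisation at `c`. It is smooth only on the
chart domain; cutoffs make global test fields out of it. -/
theorem exists_coordinate_field {c x : M} (hx : x ∈ (chartAt (Model n) c).source)
    (v : TangentSpace (𝓡 n) x) : ∃ X : Π x : M, TangentSpace (𝓡 n) x, X x = v ∧
      ContMDiffOn (𝓡 n) (𝓡 n).tangent ∞ (fun x => (⟨x, X x⟩ : TangentBundle (𝓡 n) M))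
        (chartAt (Model n) c).source := by
  have : IsManifold (𝓡 n) 1 M := .of_le (n := ∞) (by exact_mod_cast le_top)
  set e := trivializationAt (Model n) (TangentSpace (𝓡 n) : M → Type _) c
  have hb : ∀ z ∈ (chartAt (Model n) c).source, z ∈ e.baseSet := fun z hz => by simpa [e] using hz
  refine ⟨fun z => e.symmL ℝ z (e.continuousLinearMapAt ℝ x v),
    e.symmL_continuousLinearMapAt (hb x hx) v, ?_⟩
  refine (contMDiffOn_iff_dchart (𝓡 n) (p := id) (mapsTo_id _)).2 ⟨contMDiffOn_id, ?_⟩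
  refine (contMDiffOn_const (c := (e.continuousLinearMapAt ℝ x v : Model n))).congr fun z hz => ?_
  have h1 := TangentBundle.continuousLinearMapAt_trivializationAt (I := 𝓡 n) hz
  refine (DFunLike.congr_fun h1 _).symm.trans ?_
  exact e.continuousLinearMapAt_symmL (hb z hz) _

end Fields

/-! ### Algebraic rules for the divergence -/

section DivergenceCalculus

variable {n : ℕ} {M : Type*} [TopologicalSpace M] [ChartedSpace (Model n) M]
  [IsManifold (𝓡 n) ∞ M] [CompactSpace M] [T2Space M] [MeasurableSpace M] [BorelSpace M]

theorem divg_neg (g : RMetric n M) {u : Π x : M, TangentSpace (𝓡 n) x} (hu : SmoothField u)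
    (x : M) : divg g (fun x => -u x) x = -divg g u x := by
  refine congrFun (eq_of_forall_integral_mul_eq g (F' := fun x => -divg g u x)
    (divg_contMDiff g hu.neg).continuous (divg_contMDiff g hu).continuous.neg fun k hk => ?_) x
  rw [integral_mul_divg g hu.neg hk]
  simp only [mul_neg, map_neg, integral_neg]
  rw [integral_mul_divg g hu hk]

theorem divg_add (g : RMetric n M) {u v : Π x : M, TangentSpace (𝓡 n) x} (hu : SmoothField u)
    (hv : SmoothField v) (x : M) :
    divg g (fun x => u x + v x) x = divg g u x + divg g v x := by
  have hcu := (divg_contMDiff g hu).continuous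
  have hcv := (divg_contMDiff g hv).continuous
  refine congrFun (eq_of_forall_integral_mul_eq g (F' := fun x => divg g u x + divg g v x)
    (divg_contMDiff g (hu.add hv)).continuous (hcu.add hcv) fun k hk => ?_) x
  rw [integral_mul_divg g (hu.add hv) hk]
  simp only [mul_add, map_add]
  rw [integral_add (integrable_vol g (dFun_apply_contMDiff hk hu).continuous)
    (integrable_vol g (dFun_apply_contMDiff hk hv).continuous),
    integral_add (integrable_vol g (f := fun x => k x * divg g u x) (hk.continuous.mul hcu))
    (integrable_vol g (f := fun x => k x * divg g v x) (hk.continuous.mul hcv)),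
    integral_mul_divg g hu hk, integral_mul_divg g hv hk]
  ring

/-- This is the divergence theorem for the product `h f`, expanded by the Leibniz rule. -/
theorem integral_mul_dFun (g : RMetric n M) {u : Π x : M, TangentSpace (𝓡 n) x}
    (hu : SmoothField u) {f h : M → ℝ} (hf : ContMDiff (𝓡 n) 𝓘(ℝ, ℝ) ∞ f)
    (hh : ContMDiff (𝓡 n) 𝓘(ℝ, ℝ) ∞ h) :
    ∫ x, dFun h x (u x) * f x ∂(vol g) =
      -∫ x, h x * (f x * divg g u x + dFun f x (u x)) ∂(vol g) := by
  have h1 := integral_mul_divg g hu (hh.mul hf)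
  have e : ∀ x, dFun (h * f) x (u x) = h x * dFun f x (u x) + dFun h x (u x) * f x := fun x => by
    rw [mul_comm (dFun h x (u x))]
    exact dFun_mul (mdifferentiableAt_of_contMDiff hh x) (mdifferentiableAt_of_contMDiff hf x) (u x)
  have hc1 : Continuous fun x => h x * dFun f x (u x) :=
    hh.continuous.mul (dFun_apply_contMDiff hf hu).continuous
  have hc2 : Continuous fun x => dFun h x (u x) * f x :=
    (dFun_apply_contMDiff hh hu).continuous.mul hf.continuous
  have hc3 : Continuous fun x => h x * f x * divg g u x :=
    (hh.continuous.mul hf.continuous).mul (divg_contMDiff g hu).continuous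
  simp only [e, Pi.mul_apply] at h1
  rw [integral_add (integrable_vol g hc1) (integrable_vol g hc2)] at h1
  have h2 : ∫ x, h x * (f x * divg g u x + dFun f x (u x)) ∂(vol g) =
      ∫ x, h x * f x * divg g u x ∂(vol g) + ∫ x, h x * dFun f x (u x) ∂(vol g) := by
    rw [← integral_add (integrable_vol g hc3) (integrable_vol g hc1)]
    exact integral_congr_ae (Filter.Eventually.of_forall fun x => by ring)
  rw [h2, h1]
  ring

/-- `div [w, u] = w(div u) - u(div w)`. -/
theorem divg_mlieBracket (g : RMetric n M) {w u : Π x : M, TangentSpace (𝓡 n) x}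
    (hw : SmoothField w) (hu : SmoothField u) (x : M) :
    divg g (VectorField.mlieBracket (𝓡 n) w u) x =
      dFun (divg g u) x (w x) - dFun (divg g w) x (u x) := by
  have hdu := divg_contMDiff g hu
  have hdw := divg_contMDiff g hw
  have hc1 := (dFun_apply_contMDiff hdu hw).continuous
  have hc2 := (dFun_apply_contMDiff hdw hu).continuous
  have hb := smoothField_mlieBracket hw hu
  refine congrFun (eq_of_forall_integral_mul_eq g
    (F' := fun x => dFun (divg g u) x (w x) - dFun (divg g w) x (u x))
    (divg_contMDiff g hb).continuous (hc1.sub hc2) fun k hk => ?_) x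
  have hku := dFun_apply_contMDiff hk hu
  have hkw := dFun_apply_contMDiff hk hw
  rw [integral_mul_divg g hb hk]
  simp only [dFun_mlieBracket hk hw hu]
  rw [integral_sub (integrable_vol g (dFun_apply_contMDiff hku hw).continuous)
    (integrable_vol g (dFun_apply_contMDiff hkw hu).continuous)]
  -- Each second derivative of `k` is integrated by parts twice, moving all derivatives off `k`.
  -- Both results contain `∫ k div w div u dμ`, which drops out of the difference.
  have h1 := integral_mul_divg g hw hku
  have h2 := integral_mul_divg g hu hkw
  rw [integral_mul_dFun g hu hdw hk] at h1
  rw [integral_mul_dFun g hw hdu hk] at h2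
  have hi : ∀ {f : M → ℝ}, Continuous f → Integrable (fun x => k x * f x) (vol g) := fun hf =>
    integrable_vol g (hk.continuous.mul hf)
  simp only [mul_add, mul_sub] at h1 h2 ⊢
  rw [integral_add (hi (f := fun x => divg g w x * divg g u x) (hdw.continuous.mul hdu.continuous)) (hi hc2)] at h1
  rw [integral_add (hi (f := fun x => divg g u x * divg g w x) (hdu.continuous.mul hdw.continuous)) (hi hc1)] at h2
  rw [integral_sub (hi hc1) (hi hc2)]
  have h3 : ∫ x, k x * (divg g w x * divg g u x) ∂(vol g) =
      ∫ x, k x * (divg g u x * divg g w x) ∂(vol g) := by simp only [mul_comm (divg g w _)]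
  rw [h3] at h1
  linarith

/-- A function which is orthogonal to all divergences has vanishing differential. -/
theorem dFun_eq_zero_of_forall_integral_eq_zero (g : RMetric n M) {f : M → ℝ}
    (hf : ContMDiff (𝓡 n) 𝓘(ℝ, ℝ) ∞ f)
    (h : ∀ w : Π x : M, TangentSpace (𝓡 n) x, SmoothField w → ∫ x, f x * divg g w x ∂(vol g) = 0)
    (x : M) (v : TangentSpace (𝓡 n) x) : dFun f x v = 0 := by
  obtain ⟨X, hXv, hX⟩ := exists_coordinate_field (mem_chart_source (Model n) x) v
  have hop := (chartAt (Model n) x).open_source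
  have hw : ∀ k : M → ℝ, ContMDiff (𝓡 n) 𝓘(ℝ, ℝ) ∞ k → tsupport k ⊆ (chartAt (Model n) x).source →
      SmoothField (fun z => k z • X z) := fun k hk hs =>
    ContMDiffOn.smul_section_of_tsupport hk.contMDiffOn hop hs hX
  have hcont : ContinuousOn (fun z => dFun f z (X z)) (chartAt (Model n) x).source := by
    have hX' := ((contMDiffOn_iff_dchart (𝓡 n) (p := id) (mapsTo_id _)).1 hX).2.continuousOn
    have hf' := ((contDiffOn_chart_of_contMDiff hf x).fderiv_of_isOpen
      (chartAt (Model n) x).open_target (m := ∞) (by simp)).continuousOn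
    refine ((hf'.comp (chartAt (Model n) x).continuousOn
      fun z hz => (chartAt (Model n) x).map_source hz).clm_apply hX').congr fun z hz => ?_
    exact dFun_chart' hz (mdifferentiableAt_of_contMDiff hf z) _
  have hae : ∀ᵐ z ∂(vol g), z ∈ (chartAt (Model n) x).source → dFun f z (X z) = 0 := by
    refine hop.ae_eq_zero_of_integral_contMDiff_smul_eq_zero (𝓡 n)
      (hcont.locallyIntegrableOn hop.measurableSet) fun k hk _ hs => ?_
    -- The test field is `k X`. The divergence theorem turns the hypothesis into `∫ k df(X) dμ = 0`
    -- for every cutoff `k`.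
    have h1 := h _ (hw k hk hs)
    rw [integral_mul_divg g (hw k hk hs) hf, neg_eq_zero] at h1
    simpa using h1
  have hae2 : (fun z => dFun f z (X z)) =ᵐ[(vol g).restrict (chartAt (Model n) x).source]
      fun _ => 0 := by
    rwa [Filter.EventuallyEq, ae_restrict_iff' hop.measurableSet]
  have h2 := Measure.eqOn_open_of_ae_eq hae2 hop hcont continuousOn_const (mem_chart_source _ x)
  simpa [hXv] using h2

end DivergenceCalculus

/-! ### Time derivatives of vector fields and their divergences -/

section TimeDependent

variable {n : ℕ} {M : Type*} [TopologicalSpace M] [ChartedSpace (Model n) M]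
  [IsManifold (𝓡 n) ∞ M]

theorem chartField_contDiffOn_time {J : Set ℝ} {u : ℝ → Π x : M, TangentSpace (𝓡 n) x}
    (hu : SmoothTimeField J u) (c : M) :
    ContDiffOn ℝ ∞ (fun p : ℝ × Model n => chartField (u p.1) c p.2)
      (J ×ˢ (chartAt (Model n) c).target) := by
  have h2 : ContMDiffOn (𝓘(ℝ, ℝ).prod (𝓡 n)) (𝓘(ℝ, ℝ).prod (𝓡 n)) ∞
      (fun p : ℝ × Model n => (p.1, (chartAt (Model n) c).symm p.2))
      (J ×ˢ (chartAt (Model n) c).target) :=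
    contMDiffOn_fst.prodMk ((contMDiffOn_chart_symm c).comp contMDiffOn_snd fun p hp => hp.2)
  have h3 : ContMDiffOn (𝓘(ℝ, ℝ).prod (𝓡 n)) (𝓡 n).tangent ∞
      (fun p : ℝ × Model n => (⟨(chartAt (Model n) c).symm p.2,
        u p.1 ((chartAt (Model n) c).symm p.2)⟩ : TangentBundle (𝓡 n) M))
      (J ×ˢ (chartAt (Model n) c).target) :=
    ContMDiffOn.comp (g := fun p : ℝ × M => (⟨p.2, u p.1 p.2⟩ : TangentBundle (𝓡 n) M))
      hu h2 fun p hp => ⟨hp.1, mem_univ _⟩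
  exact contMDiffOn_prod_iff_contDiffOn.1 ((contMDiffOn_iff_dchart (𝓘(ℝ, ℝ).prod (𝓡 n)) (c := c)
    fun p hp => (chartAt (Model n) c).map_target hp.2).1 h3).2

theorem SmoothTimeField.slice {J : Set ℝ} {u : ℝ → Π x : M, TangentSpace (𝓡 n) x}
    (hu : SmoothTimeField J u) {t : ℝ} (ht : t ∈ J) : SmoothField (u t) :=
  smoothField_of_chartField fun c => (chartField_contDiffOn_time hu c).comp
    (f := fun y : Model n => (t, y)) (contDiffOn_const.prodMk contDiffOn_id) fun _ hy => ⟨ht, hy⟩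

theorem hasDerivAt_chartField {J : Set ℝ} (hJ : IsOpen J)
    {u : ℝ → Π x : M, TangentSpace (𝓡 n) x} (hu : SmoothTimeField J u) {t : ℝ} (ht : t ∈ J)
    {c : M} {y : Model n} (hy : y ∈ (chartAt (Model n) c).target) :
    HasDerivAt (fun s => chartField (u s) c y) (chartField (timeDeriv u t) c y) t := by
  have hd := hasDerivAt_curry_left (((chartField_contDiffOn_time hu c).contDiffAt
    ((isOpen_prod_target (n := n) hJ c).mem_nhds ⟨ht, hy⟩)).differentiableAt (by simp))
  set d := fderiv ℝ (fun p : ℝ × Model n => chartField (u p.1) c p.2) (t, y) (1, 0)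
  simp only at hd
  -- At a fixed point the field moves in one fixed tangent space, and `L`, the inverse of the
  -- differential of the chart there, is independent of time. It therefore commutes with the time
  -- derivative.
  let L : Model n →L[ℝ] Model n := mfderiv (𝓡 n) (𝓡 n) (chartAt (Model n) c).symm y
  have hL : ∀ s, u s ((chartAt (Model n) c).symm y) = L (chartField (u s) c y) := by
    intro s
    have h := (mdifferentiable_chartAt c).symm_comp_deriv ((chartAt (Model n) c).map_target hy)
    have h' := DFunLike.congr_fun h (u s ((chartAt (Model n) c).symm y))
    rw [(chartAt (Model n) c).right_inv hy] at h'
    exact h'.symm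
  have h1 : HasDerivAt (fun s => L (chartField (u s) c y)) (L d) t :=
    L.hasFDerivAt.comp_hasDerivAt t hd
  have h2 : timeDeriv u t ((chartAt (Model n) c).symm y) = L d := by
    refine Eq.trans ?_ h1.deriv
    exact congrArg (fun f : ℝ → Model n => deriv f t) (funext hL)
  have h3 : chartField (timeDeriv u t) c y = d := by
    unfold chartField
    rw [h2]
    exact DFunLike.congr_fun ((mdifferentiable_chartAt c).comp_symm_deriv hy) d
  rwa [h3]

theorem smoothField_timeDeriv {J : Set ℝ} (hJ : IsOpen J)
    {u : ℝ → Π x : M, TangentSpace (𝓡 n) x} (hu : SmoothTimeField J u) {t : ℝ} (ht : t ∈ J) :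
    SmoothField (timeDeriv u t) := by
  refine smoothField_of_chartField fun c => ?_
  have hop := isOpen_prod_target (n := n) hJ c
  have h1 := (contDiffOn_fderiv_apply hop (chartField_contDiffOn_time hu c) (1, 0)).comp
    (f := fun y : Model n => (t, y)) (s := (chartAt (Model n) c).target)
    (contDiffOn_const.prodMk contDiffOn_id) fun _ hy => ⟨ht, hy⟩
  refine h1.congr fun y hy => ?_
  exact (hasDerivAt_chartField hJ hu ht hy).unique (hasDerivAt_curry_left
    (((chartField_contDiffOn_time hu c).contDiffAt (hop.mem_nhds ⟨ht, hy⟩)).differentiableAt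
      (by simp)))

/-- `∂_t div u = div u_t`. -/
theorem hasDerivAt_divg (g : RMetric n M) {J : Set ℝ} (hJ : IsOpen J)
    {u : ℝ → Π x : M, TangentSpace (𝓡 n) x} (hu : SmoothTimeField J u) {t : ℝ} (ht : t ∈ J)
    (x : M) : HasDerivAt (fun s => divg g (u s) x) (divg g (timeDeriv u t) x) t := by
  have hop := isOpen_prod_target (n := n) hJ x
  have hy := mem_chart_target (Model n) x
  have hf : ∀ i, ContDiffOn ℝ ∞ (fun p : ℝ × Model n => sqrtDet g x p.2 * comp (u p.1) x p.2 i)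
      (J ×ˢ (chartAt (Model n) x).target) := fun i =>
    ((sqrtDet_contDiffOn g x).comp contDiffOn_snd fun p hp => hp.2).mul
      (contDiffOn_euclidean.1 (chartField_contDiffOn_time hu x) i)
  unfold divg
  refine HasDerivAt.const_mul _ (HasDerivAt.fun_sum fun i _ => ?_)
  have h : HasDerivAt
      (fun r => partialD i (fun y => sqrtDet g x y * comp (u r) x y i) (chartAt (Model n) x x))
      (fderiv ℝ (fun y => deriv (fun r => sqrtDet g x y * comp (u r) x y i) t)
        (chartAt (Model n) x x) (stdVec i)) t :=
    hasDerivAt_fderiv_curry hop (hf i) ⟨ht, hy⟩ (stdVec i)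
  have e : (fun y => deriv (fun r => sqrtDet g x y * comp (u r) x y i) t)
      =ᶠ[𝓝 (chartAt (Model n) x x)] fun y => sqrtDet g x y * comp (timeDeriv u t) x y i := by
    filter_upwards [(chartAt (Model n) x).open_target.mem_nhds hy] with y hy
    have h1 := (EuclideanSpace.proj (𝕜 := ℝ) i : Model n →L[ℝ] ℝ).hasFDerivAt.comp_hasDerivAt t
      (hasDerivAt_chartField hJ hu ht hy)
    exact (h1.const_mul (sqrtDet g x y)).deriv
  rw [e.fderiv_eq] at h
  exact h

end TimeDependent

/-! ### Differentiation under the integral and the variation of the Jacobian -/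

section ParametricIntegral

variable {n : ℕ} {M : Type*} [TopologicalSpace M] [ChartedSpace (Model n) M]
  [IsManifold (𝓡 n) ∞ M]

theorem SmoothFunCurve.deriv {F : ℝ → M → ℝ} (hF : SmoothFunCurve (n := n) F) :
    SmoothFunCurve (n := n) (fun t x => deriv (fun s => F s x) t) := by
  have h := deriv_fst_contMDiffOn (n := n) isOpen_univ (f := fun p : ℝ × M => F p.1 p.2)
    (ContMDiff.contMDiffOn hF)
  rw [univ_prod_univ, contMDiffOn_univ] at h
  exact h

theorem SmoothFunCurve.hasDerivAt {F : ℝ → M → ℝ} (hF : SmoothFunCurve (n := n) F) (t : ℝ) (x : M) :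
    HasDerivAt (fun s => F s x) (_root_.deriv (fun s => F s x) t) t := by
  have h := (contMDiffAt_prod_iff_chart' (mem_chart_source (Model n) x)).1 (hF (t, x))
  have h1 := hasDerivAt_curry_left (h.differentiableAt (by simp))
  simp only [(chartAt (Model n) x).left_inv (mem_chart_source _ x)] at h1
  exact h1.differentiableAt.hasDerivAt

variable [CompactSpace M] [T2Space M] [MeasurableSpace M] [BorelSpace M]

theorem SmoothFunCurve.hasDerivAt_integral (g : RMetric n M) {F : ℝ → M → ℝ}
    (hF : SmoothFunCurve (n := n) F) (t : ℝ) :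
    HasDerivAt (fun s => ∫ x, F s x ∂(vol g)) (∫ x, _root_.deriv (fun s => F s x) t ∂(vol g)) t := by
  have hF' := hF.deriv
  -- By compactness of `[t - 1, t + 1] × M` the time derivative is dominated by a constant, which is
  -- integrable since `vol` is finite.
  obtain ⟨C, hC⟩ := ((isCompact_closedBall t 1).prod (isCompact_univ (X := M))).exists_bound_of_continuousOn
    (f := fun p : ℝ × M => _root_.deriv (fun s => F s p.2) p.1) (ContMDiff.continuous hF').continuousOn
  refine (hasDerivAt_integral_of_dominated_loc_of_deriv_le (bound := fun _ => C)
    (F := F) (F' := fun s x => _root_.deriv (fun r => F r x) s) (Metric.ball_mem_nhds t one_pos)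
    ?_ ?_ ?_ ?_ ?_ ?_).2
  · exact Filter.Eventually.of_forall fun s => (hF.slice s).continuous.aestronglyMeasurable
  · exact integrable_vol g (hF.slice t).continuous
  · exact (hF'.slice t).continuous.aestronglyMeasurable
  · exact Filter.Eventually.of_forall fun x s hs =>
      hC (s, x) ⟨Metric.ball_subset_closedBall hs, mem_univ _⟩
  · exact integrable_const _
  · exact Filter.Eventually.of_forall fun x s _ => hF.hasDerivAt s x

theorem SmoothFunCurve.contDiff_integral (g : RMetric n M) {F : ℝ → M → ℝ}
    (hF : SmoothFunCurve (n := n) F) : ContDiff ℝ ∞ (fun s => ∫ x, F s x ∂(vol g)) := by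
  refine contDiff_infty.2 fun m => ?_
  induction m generalizing F with
  | zero =>
    exact contDiff_zero.2 (continuous_iff_continuousAt.2 fun t =>
      (hF.hasDerivAt_integral g t).continuousAt)
  | succ m ih =>
    push_cast
    refine contDiff_succ_iff_deriv.2 ⟨fun t => (hF.hasDerivAt_integral g t).differentiableAt,
      fun h => absurd h (by simp), ?_⟩
    rw [show _root_.deriv (fun s => ∫ x, F s x ∂(vol g)) = _ from
      funext fun t => (hF.hasDerivAt_integral g t).deriv]
    exact ih hF.deriv

/-- The differential of `η ↦ Jac_μ(η)`. -/
theorem deriv_jac (g : RMetric n M) {η : ℝ → M ≃ₘ^∞⟮𝓡 n, 𝓡 n⟯ M} (hη : SmoothDiffCurve η)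
    {u : Π x : M, TangentSpace (𝓡 n) x} (hu : SmoothField u) (hηu : HasVelocity η u) (x : M) :
    deriv (fun s => jac g (η s) x) 0 = divg g u (η 0 x) * jac g (η 0) x := by
  have hj := jac_contMDiff_curve g hη
  have hη0 : Continuous (η 0) := (η 0).contMDiff.continuous
  have hdu := divg_contMDiff g hu
  have hq := (hj.deriv.slice 0).continuous
  have hj0 := (jac_contMDiff g (η 0)).continuous
  refine congrFun (eq_of_forall_integral_mul_eq g (F := fun x => deriv (fun s => jac g (η s) x) 0)
    (F' := fun x => divg g u (η 0 x) * jac g (η 0) x)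
    hq ((hdu.continuous.comp hη0).mul hj0) fun h hh => ?_) x
  -- With `k = h ∘ η₀⁻¹` the composite `k ∘ η_s` equals the test function `h` at time `0`, while `∫
  -- Jac(η_s) (k ∘ η_s) dμ` does not depend on `s`.
  set k : M → ℝ := fun x => h ((η 0).symm x) with hkdef
  have hk : ContMDiff (𝓡 n) 𝓘(ℝ, ℝ) ∞ k := ContMDiff.comp (g := h) hh (η 0).symm.contMDiff
  have hkη : ∀ x, k (η 0 x) = h x := fun x => by simp [hkdef]
  have hkη' : SmoothFunCurve (n := n) (fun s x => k (η s x)) :=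
    ContMDiff.comp (g := k) (f := fun p : ℝ × M => η p.1 p.2) hk hη
  have hF : SmoothFunCurve (n := n) (fun s x => jac g (η s) x * k (η s x)) := ContMDiff.mul hj hkη'
  have hdk : ∀ x, deriv (fun s => k (η s x)) 0 = dFun k (η 0 x) (u (η 0 x)) := by
    intro x
    have hη1 : MDifferentiableAt 𝓘(ℝ, ℝ) (𝓡 n) (fun s => η s x) 0 := by
      have h1 : ContMDiff 𝓘(ℝ, ℝ) (𝓘(ℝ, ℝ).prod (𝓡 n)) ∞ (fun s : ℝ => (s, x)) :=
        contMDiff_id.prodMk contMDiff_const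
      exact (ContMDiff.comp (g := fun p : ℝ × M => η p.1 p.2) hη h1).mdifferentiable (by simp) 0
    have h2 := mfderiv_comp (0 : ℝ) (g := k) (f := fun s => η s x) (mdifferentiableAt_of_contMDiff hk _) hη1
    rw [mfderiv_eq_fderiv] at h2
    have h3 := DFunLike.congr_fun h2 (1 : ℝ)
    rw [← hηu x]
    exact h3
  have hderiv : ∀ x, deriv (fun s => jac g (η s) x * k (η s x)) 0 =
      h x * deriv (fun s => jac g (η s) x) 0 + jac g (η 0) x * dFun k (η 0 x) (u (η 0 x)) := by
    intro x
    refine ((hj.hasDerivAt 0 x).mul (hkη'.hasDerivAt 0 x)).deriv.trans ?_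
    rw [hdk, hkη]
    ring
  have hint := hF.hasDerivAt_integral g 0
  have hconst : (fun s => ∫ x, jac g (η s) x * k (η s x) ∂(vol g)) = fun _ => ∫ x, k x ∂(vol g) :=
    funext fun s => integral_jac_mul_comp g (η s) hk.continuous
  rw [hconst] at hint
  have h0 := hint.unique (hasDerivAt_const _ _)
  simp only [hderiv] at h0
  have hcd : Continuous fun x => dFun k x (u x) := (dFun_apply_contMDiff hk hu).continuous
  rw [integral_add (integrable_vol g (f := fun x => h x * deriv (fun s => jac g (η s) x) 0)
    (hh.continuous.mul hq)) (integrable_vol g (f := fun x => jac g (η 0) x *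
      dFun k (η 0 x) (u (η 0 x))) (hj0.mul (hcd.comp hη0))),
    integral_jac_mul_comp g (η 0) (h := fun x => dFun k x (u x)) hcd] at h0
  have h1 := integral_mul_divg g hu hk
  rw [← integral_jac_mul_comp g (η 0) (h := fun x => k x * divg g u x)
    (hk.continuous.mul hdu.continuous)] at h1
  have h2 : ∫ x, h x * (divg g u (η 0 x) * jac g (η 0) x) ∂(vol g) =
      ∫ x, jac g (η 0) x * (k (η 0 x) * divg g u (η 0 x)) ∂(vol g) := by
    refine integral_congr_ae (Filter.Eventually.of_forall fun x => ?_)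
    simp only [hkη]
    ring
  rw [h2, h1]
  linarith

end ParametricIntegral

/-! ### Bi-invariance, degeneracy and descent -/

section MainResults

variable {n : ℕ} {M : Type*} [TopologicalSpace M] [ChartedSpace (Model n) M]
  [IsManifold (𝓡 n) ∞ M] [CompactSpace M] [T2Space M] [MeasurableSpace M] [BorelSpace M]

omit [BorelSpace M] in
theorem abc_eq_integral_divg (g : RMetric n M) (b : ℝ) (u v : Π x : M, TangentSpace (𝓡 n) x) :
    abc g 0 b 0 u v = b * ∫ x, divg g u x * divg g v x ∂(vol g) := by
  simp [abc, codiff_flat]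

theorem divg_adj (g : RMetric n M) {u v : Π x : M, TangentSpace (𝓡 n) x} (hu : SmoothField u)
    (hv : SmoothField v) (x : M) :
    divg g (adj u v) x = dFun (divg g u) x (v x) - dFun (divg g v) x (u x) := by
  refine (divg_neg g (smoothField_mlieBracket hu hv) x).trans ?_
  rw [divg_mlieBracket g hu hv]
  ring

theorem abc_adj_of_divFree (g : RMetric n M) (b : ℝ) {u v w : Π x : M, TangentSpace (𝓡 n) x}
    (hu : SmoothField u) (hw : DivFree g w) :
    abc g 0 b 0 v (adj w u) = -(b * ∫ x, dFun (divg g u) x (w x) * divg g v x ∂(vol g)) := by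
  have hd : divg g w = fun _ => 0 := funext hw.2
  rw [abc_eq_integral_divg, ← mul_neg, ← integral_neg]
  congr 2
  funext x
  rw [divg_adj g hw.1 hu, hd, dFun_const]
  ring

/-- A divergence-free field acts on functions as a derivation that is skew for `∫ · dμ`, and `ad_w`
acts on divergences as minus this derivation. -/
theorem biInvariant_divergence_metric (g : RMetric n M) (b : ℝ) : BiInvariant g 0 b 0 := by
  intro u v w hu hv hw
  rw [abc_adj_of_divFree g b hu.1 hw, abc_adj_of_divFree g b hv.1 hw,
    integral_mul_dFun g hw.1 (divg_contMDiff g hv.1) (divg_contMDiff g hu.1)]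
  simp only [hw.2, mul_zero, zero_add, mul_comm (divg g u _)]
  ring

theorem eq_zero_of_integral_mul_self_eq_zero (g : RMetric n M) {f : M → ℝ} (hf : Continuous f)
    (h : ∫ x, f x * f x ∂(vol g) = 0) : f = 0 := by
  have h1 := (integral_eq_zero_iff_of_nonneg (μ := vol g) (f := fun x => f x * f x)
    (fun x => mul_self_nonneg _) (integrable_vol g (hf.mul hf))).1 h
  have h2 := (Continuous.ae_eq_iff_eq (vol g) (hf.mul hf) continuous_zero).1 h1
  funext x
  exact mul_self_eq_zero.1 (congrFun h2 x)

theorem degenerate_iff_divg_eq_zero (g : RMetric n M) {b : ℝ} (hb : 0 < b)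
    {u : Π x : M, TangentSpace (𝓡 n) x} (hu : SmoothField u) :
    (∀ v, SmoothField v → abc g 0 b 0 u v = 0) ↔ ∀ x, divg g u x = 0 := by
  constructor
  · intro h x
    have h1 := h u hu
    rw [abc_eq_integral_divg, mul_eq_zero] at h1
    exact congrFun (eq_zero_of_integral_mul_self_eq_zero g (divg_contMDiff g hu).continuous
      (h1.resolve_left hb.ne')) x
  · intro h v _
    simp [abc_eq_integral_divg, h]

/-- The metric `b ∫ f h / R dμ` on the space of densities. -/
def densMetric (g : RMetric n M) (b : ℝ) (R f h : M → ℝ) : ℝ :=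
  b * ∫ x, f x * h x / R x ∂(vol g)

theorem isWeakRiemannianMetric_densMetric (g : RMetric n M) {b : ℝ} (hb : 0 < b) :
    IsWeakRiemannianMetric g (densMetric g b) where
  symm R f h _ _ _ := by simp only [densMetric, mul_comm (f _)]
  add_left R f₁ f₂ h hR hf₁ hf₂ hh := by
    have hi : ∀ f : M → ℝ, IsTangentDens g f → Integrable (fun x => f x * h x / R x) (vol g) :=
      fun f hf => integrable_vol g ((hf.1.continuous.mul hh.1.continuous).div hR.1.continuous
        fun x => (hR.2.1 x).ne')
    simp only [densMetric, Pi.add_apply, add_mul, add_div]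
    rw [integral_add (hi f₁ hf₁) (hi f₂ hf₂), mul_add]
  smul_left R r f h _ _ _ := by
    simp only [densMetric, Pi.smul_apply, smul_eq_mul, mul_assoc, mul_div_assoc]
    rw [integral_const_mul]
    ring
  pos R f hR hf hne := by
    have hc : Continuous fun x => f x * f x / R x :=
      (hf.1.continuous.mul hf.1.continuous).div hR.1.continuous fun x => (hR.2.1 x).ne'
    have hnn : ∀ x, 0 ≤ f x * f x / R x := fun x =>
      div_nonneg (mul_self_nonneg _) (hR.2.1 x).le
    refine mul_pos hb (lt_of_le_of_ne (integral_nonneg hnn) fun h0 => hne ?_)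
    have h1 := (integral_eq_zero_iff_of_nonneg hnn (integrable_vol g hc)).1 h0.symm
    have h2 := (Continuous.ae_eq_iff_eq (vol g) hc continuous_zero).1 h1
    funext x
    have h3 := congrFun h2 x
    simpa [(hR.2.1 x).ne'] using h3
  smooth R f h hR hf hh hRd _ _ := by
    have hF : SmoothFunCurve (n := n) (fun s x => f s x * h s x / R s x) :=
      -- Positivity of the densities keeps the integrand jointly smooth, so smoothness of `G`
      -- reduces to integrals depending on a parameter.
      ContMDiff.div₀ (ContMDiff.mul hf hh) hR fun p => ((hRd p.1).2.1 p.2).ne'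
    exact contDiff_const.mul (hF.contDiff_integral g)

theorem isDens_jac (g : RMetric n M) (η : M ≃ₘ^∞⟮𝓡 n, 𝓡 n⟯ M) : IsDens g (jac g η) := by
  refine ⟨jac_contMDiff g η, jac_pos g η, ?_⟩
  have h := integral_jac_mul_comp g η (h := fun _ => (1 : ℝ)) continuous_const
  simpa using h

omit [CompactSpace M] [T2Space M] [MeasurableSpace M] [BorelSpace M] in
theorem jac_eq_jac_iff (g : RMetric n M) (η ξ : M ≃ₘ^∞⟮𝓡 n, 𝓡 n⟯ M) :
    jac g η = jac g ξ ↔ ∃ h : M ≃ₘ^∞⟮𝓡 n, 𝓡 n⟯ M, jac g h = 1 ∧ ξ = η.trans h := by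
  constructor
  · intro h
    have hξ : ξ = η.trans (η.symm.trans ξ) := Diffeomorph.ext fun x => by simp
    -- As `trans` applies its left factor first, the witness is `ξ ∘ η⁻¹`, whose Jacobian is the
    -- quotient of the two equal Jacobians.
    refine ⟨η.symm.trans ξ, funext fun y => ?_, hξ⟩
    have h1 := jac_trans g η (η.symm.trans ξ) (η.symm y)
    rw [← hξ, ← h, η.apply_symm_apply] at h1
    exact mul_right_cancel₀ (jac_pos g η (η.symm y)).ne' (by rw [← h1]; simp)
  · rintro ⟨h, hh, rfl⟩
    funext x
    rw [jac_trans, hh]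
    simp

/-- The integrand `f h / R` has degree one in Jacobians: a pulled-back triple produces `J · J / J =
J`, exactly the factor absorbed by the change of variables. Both invariance and the submersion
property rest on this. -/
theorem descendsTo_densMetric (g : RMetric n M) {b : ℝ} (hb : 0 < b) :
    DescendsTo g 0 b 0 (densMetric g b) where
  metric := isWeakRiemannianMetric_densMetric g hb
  invariant ξ R f h hR hf hh := by
    have hc : Continuous fun x => f x * h x / R x :=
      (hf.1.continuous.mul hh.1.continuous).div hR.1.continuous fun x => (hR.2.1 x).ne'
    rw [densMetric, densMetric, ← integral_jac_mul_comp g ξ hc]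
    congr 2
    funext x
    have h1 := (jac_pos g ξ x).ne'
    have h2 := (hR.2.1 (ξ x)).ne'
    field_simp
  mapsTo := isDens_jac g
  fibre := jac_eq_jac_iff g
  submersion η ξ u v hη hξ h0 hηu hξv hu hv := by
    have hc : Continuous fun x => divg g u x * divg g v x :=
      (divg_contMDiff g hu.1).continuous.mul (divg_contMDiff g hv.1).continuous
    rw [densMetric, abc_eq_integral_divg, ← integral_jac_mul_comp g (η 0) hc]
    congr 2
    funext x
    rw [deriv_jac g hη hu.1 hηu, deriv_jac g hξ hv.1 hξv, ← h0]
    have h1 := (jac_pos g (η 0) x).ne'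
    field_simp

/-! ### The Euler-Arnold equation -/

/-- The function `⟨u, ∇ρ⟩ + ρ² / 2` with `ρ = div u`. -/
def hsTerm (g : RMetric n M) (u : Π x : M, TangentSpace (𝓡 n) x) (x : M) : ℝ :=
  dFun (divg g u) x (u x) + divg g u x * divg g u x / 2

theorem hsTerm_contMDiff (g : RMetric n M) {u : Π x : M, TangentSpace (𝓡 n) x}
    (hu : SmoothField u) : ContMDiff (𝓡 n) 𝓘(ℝ, ℝ) ∞ (hsTerm g u) := by
  have hd := divg_contMDiff g hu
  exact (dFun_apply_contMDiff hd hu).add ((hd.mul hd).div_const 2)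

/-- The divergence theorem with test function `ρ` gives `∫ dρ(u) dμ = -∫ ρ² dμ`, and half of it is
compensated by `ρ²/2`. -/
theorem integral_hsTerm (g : RMetric n M) {u : Π x : M, TangentSpace (𝓡 n) x}
    (hu : SmoothField u) :
    ∫ x, hsTerm g u x ∂(vol g) = -(∫ x, divg g u x ^ 2 ∂(vol g)) / 2 := by
  have hd := divg_contMDiff g hu
  have h := integral_mul_divg g hu hd
  simp only [hsTerm, pow_two]
  rw [integral_add (integrable_vol g (dFun_apply_contMDiff hd hu).continuous)
    (integrable_vol g (f := fun x => divg g u x * divg g u x / 2)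
      ((hd.continuous.mul hd.continuous).div_const 2)), integral_div]
  linarith

/-- With `div (ad_u w) = dρ(w) - d(div w)(u)`, integration by parts yields `∫ ρ dρ(w) dμ = -½ ∫ ρ²
div w dμ` and `-∫ ρ d(div w)(u) dμ = ∫ (ρ² + dρ(u)) div w dμ`. Adding them leaves the coefficient
`½` of `ρ²`. -/
theorem abc_adj_self (g : RMetric n M) (b : ℝ) {u w : Π x : M, TangentSpace (𝓡 n) x}
    (hu : SmoothField u) (hw : SmoothField w) :
    abc g 0 b 0 u (adj u w) = b * ∫ x, hsTerm g u x * divg g w x ∂(vol g) := by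
  have hdu := divg_contMDiff g hu
  have hdw := divg_contMDiff g hw
  have c1 : Continuous fun x => dFun (divg g u) x (w x) * divg g u x :=
    (dFun_apply_contMDiff hdu hw).continuous.mul hdu.continuous
  have c2 : Continuous fun x => dFun (divg g w) x (u x) * divg g u x :=
    (dFun_apply_contMDiff hdw hu).continuous.mul hdu.continuous
  have c3 : Continuous fun x => divg g w x * divg g u x ^ 2 :=
    hdw.continuous.mul (hdu.continuous.pow 2)
  have c4 : Continuous fun x => divg g w x * dFun (divg g u) x (u x) :=
    hdw.continuous.mul (dFun_apply_contMDiff hdu hu).continuous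
  have h1 := integral_mul_dFun g hu hdu hdw
  have h2 := integral_mul_dFun g hw hdu hdu
  have e1 : ∫ x, divg g w x * (divg g u x * divg g u x + dFun (divg g u) x (u x)) ∂(vol g) =
      ∫ x, divg g w x * divg g u x ^ 2 ∂(vol g) +
        ∫ x, divg g w x * dFun (divg g u) x (u x) ∂(vol g) := by
    rw [← integral_add (integrable_vol g c3) (integrable_vol g c4)]
    exact integral_congr_ae (Filter.Eventually.of_forall fun x => by ring)
  have e2 : ∫ x, divg g u x * (divg g u x * divg g w x + dFun (divg g u) x (w x)) ∂(vol g) =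
      ∫ x, divg g w x * divg g u x ^ 2 ∂(vol g) +
        ∫ x, dFun (divg g u) x (w x) * divg g u x ∂(vol g) := by
    rw [← integral_add (integrable_vol g c3) (integrable_vol g c1)]
    exact integral_congr_ae (Filter.Eventually.of_forall fun x => by ring)
  have e3 : ∫ x, hsTerm g u x * divg g w x ∂(vol g) =
      ∫ x, divg g w x * dFun (divg g u) x (u x) ∂(vol g) +
        (∫ x, divg g w x * divg g u x ^ 2 ∂(vol g)) / 2 := by
    rw [← integral_div, ← integral_add (integrable_vol g c4) (integrable_vol g (c3.div_const 2))]
    refine integral_congr_ae (Filter.Eventually.of_forall fun x => ?_)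
    simp only [hsTerm]
    ring
  have e4 : ∫ x, divg g u x * divg g (adj u w) x ∂(vol g) =
      ∫ x, dFun (divg g u) x (w x) * divg g u x ∂(vol g) -
        ∫ x, dFun (divg g w) x (u x) * divg g u x ∂(vol g) := by
    rw [← integral_sub (integrable_vol g c1) (integrable_vol g c2)]
    refine integral_congr_ae (Filter.Eventually.of_forall fun x => ?_)
    simp only [divg_adj g hu hw]
    ring
  rw [abc_eq_integral_divg, e3, e4]
  congr 1
  rw [e1] at h1
  rw [e2] at h2
  linarith

variable [ConnectedSpace M]

theorem vol_real_univ_pos (g : RMetric n M) : 0 < (vol g).real univ :=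
  ENNReal.toReal_pos (isOpen_univ.measure_ne_zero _ univ_nonempty) (measure_ne_top _ _)

/-- A constant value of `div X + ⟨u, ∇ρ⟩ + ρ² / 2` is determined by integration over `M`. -/
theorem eq_of_divg_add_hsTerm_eq_const (g : RMetric n M) {X u : Π x : M, TangentSpace (𝓡 n) x}
    (hX : SmoothField X) (hu : SmoothField u) {r : ℝ}
    (h : ∀ x, divg g X x + hsTerm g u x = r) :
    r = -(∫ y, divg g u y ^ 2 ∂(vol g)) / (2 * (vol g).real univ) := by
  have hv := vol_real_univ_pos g
  have h1 : ∫ x, (divg g X x + hsTerm g u x) ∂(vol g) = (vol g).real univ * r := by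
    simp [h]
  rw [integral_add (integrable_vol g (divg_contMDiff g hX).continuous)
    (integrable_vol g (hsTerm_contMDiff g hu).continuous), integral_divg g hX,
    integral_hsTerm g hu] at h1
  field_simp
  linarith

/-- Connectedness makes a function with zero differential constant, and its integral leaves only one
possible value. -/
theorem divg_add_hsTerm_eq_const_iff (g : RMetric n M) {X u : Π x : M, TangentSpace (𝓡 n) x}
    (hX : SmoothField X) (hu : SmoothField u) :
    (∀ x, divg g X x + hsTerm g u x =
        -(∫ y, divg g u y ^ 2 ∂(vol g)) / (2 * (vol g).real univ)) ↔
      ∀ x (v : TangentSpace (𝓡 n) x), dFun (fun x => divg g X x + hsTerm g u x) x v = 0 := by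
  constructor
  · intro h x v
    rw [show (fun x => divg g X x + hsTerm g u x) = _ from funext h]
    exact dFun_const _ _ _
  · intro h
    obtain ⟨r, hr⟩ := exists_eq_const_of_dFun_eq_zero
      ((divg_contMDiff g hX).add (hsTerm_contMDiff g hu)) h
    intro x
    rw [← eq_of_divg_add_hsTerm_eq_const g hX hu hr]
    exact hr x

/-- Here `X` stands for `u_t` at a fixed time. A representative `B` is constrained only through `div
B`, and that only up to a constant, because constants are orthogonal to divergences. -/
theorem exists_representsB_iff (g : RMetric n M) {b : ℝ} (hb : 0 < b)
    {X u : Π x : M, TangentSpace (𝓡 n) x} (hX : SmoothField X) (hu : SmoothField u) :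
    (∃ B, RepresentsB g 0 b 0 u u B ∧ DivFree g (fun x => X x + B x)) ↔
      ∀ x, divg g X x + hsTerm g u x =
        -(∫ y, divg g u y ^ 2 ∂(vol g)) / (2 * (vol g).real univ) := by
  have hK := hsTerm_contMDiff g hu
  constructor
  · rintro ⟨B, ⟨hB, hBw⟩, -, hdiv⟩
    have hdB := divg_contMDiff g hB
    refine (divg_add_hsTerm_eq_const_iff g hX hu).2 fun x v => ?_
    have e : (fun x => divg g X x + hsTerm g u x) = fun x => hsTerm g u x - divg g B x := by
      funext x
      have := hdiv x
      rw [divg_add g hX hB] at this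
      linarith
    rw [e]
    refine dFun_eq_zero_of_forall_integral_eq_zero g (hK.sub hdB) (fun w hw => ?_) x v
    have h1 := hBw w hw
    rw [abc_adj_self g b hu hw, abc_eq_integral_divg] at h1
    have h2 := mul_left_cancel₀ hb.ne' h1
    have hdw := (divg_contMDiff g hw).continuous
    simp only [sub_mul]
    rw [integral_sub (integrable_vol g (f := fun x => hsTerm g u x * divg g w x)
      (hK.continuous.mul hdw)) (integrable_vol g (f := fun x => divg g B x * divg g w x)
      (hdB.continuous.mul hdw)), h2, sub_self]
  · intro h
    -- Take `B = -X`, so that `X + B = 0`. Then `div B` differs from `hsTerm` by a constant, whose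
    -- product with `div w` integrates to zero.
    refine ⟨fun x => -X x, ⟨hX.neg, fun w hw => ?_⟩, hX.add hX.neg, fun x => ?_⟩
    · rw [abc_adj_self g b hu hw, abc_eq_integral_divg]
      congr 1
      set r := -(∫ y, divg g u y ^ 2 ∂(vol g)) / (2 * (vol g).real univ)
      have hdw := (divg_contMDiff g hw).continuous
      have e : ∀ x, divg g (fun x => -X x) x * divg g w x =
          hsTerm g u x * divg g w x - r * divg g w x := by
        intro x
        rw [divg_neg g hX, ← h x]
        ring
      simp only [e]
      rw [integral_sub (integrable_vol g (f := fun x => hsTerm g u x * divg g w x)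
        (hK.continuous.mul hdw)) (integrable_vol g (f := fun x => r * divg g w x)
        (continuous_const.mul hdw)), integral_const_mul, integral_divg g hw]
      ring
    · rw [divg_add g hX hX.neg, divg_neg g hX, add_neg_cancel]

omit [ConnectedSpace M] in
theorem dFun_divg_add_hsTerm (g : RMetric n M) {X u : Π x : M, TangentSpace (𝓡 n) x}
    (hX : SmoothField X) (hu : SmoothField u) (x : M) (v : TangentSpace (𝓡 n) x) :
    dFun (fun x => divg g X x + hsTerm g u x) x v =
      dFun (divg g X) x v + divg g u x * dFun (divg g u) x v +
        dFun (fun y => dFun (divg g u) y (u y)) x v := by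
  have hd := divg_contMDiff g hu
  have hdd := dFun_apply_contMDiff hd hu
  have hsq : ContMDiff (𝓡 n) 𝓘(ℝ, ℝ) ∞ fun x => divg g u x * divg g u x * (1 / 2) :=
    (hd.mul hd).mul contMDiff_const
  have e : hsTerm g u = fun x => dFun (divg g u) x (u x) + divg g u x * divg g u x * (1 / 2) :=
    funext fun x => by rw [hsTerm, mul_one_div]
  rw [dFun_add (mdifferentiableAt_of_contMDiff (divg_contMDiff g hX) x)
    (mdifferentiableAt_of_contMDiff (hsTerm_contMDiff g hu) x), e,
    dFun_add (mdifferentiableAt_of_contMDiff hdd x) (mdifferentiableAt_of_contMDiff hsq x),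
    dFun_mul (f := fun x => divg g u x * divg g u x) (mdifferentiableAt_of_contMDiff (hd.mul hd) x)
      (mdifferentiableAt_of_contMDiff contMDiff_const x), dFun_const,
    dFun_mul (mdifferentiableAt_of_contMDiff hd x) (mdifferentiableAt_of_contMDiff hd x)]
  ring

/-- At each time all three equations say that `div u_t + hsTerm` is constant; the third form uses in
addition that `∂_t` commutes with the divergence. -/
theorem eulerArnold_iff (g : RMetric n M) {b : ℝ} (hb : 0 < b) {J : Set ℝ} (hJ : IsOpen J)
    {u : ℝ → Π x : M, TangentSpace (𝓡 n) x} (hu : SmoothTimeField J u) :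
    (SolvesEulerArnold g 0 b 0 J u ↔ SolvesDifferentiated g J u) ∧
      (SolvesEulerArnold g 0 b 0 J u ↔ SolvesHunterSaxton g J u) := by
  constructor <;> refine forall₂_congr fun t ht => ?_
  · have hX := smoothField_timeDeriv hJ hu ht
    rw [exists_representsB_iff g hb hX (hu.slice ht),
      divg_add_hsTerm_eq_const_iff g hX (hu.slice ht)]
    refine forall_congr' fun x => ?_
    simp only [dFun_divg_add_hsTerm g hX (hu.slice ht)]
    exact ⟨fun h => ContinuousLinearMap.ext h, fun h v => DFunLike.congr_fun h v⟩
  · rw [exists_representsB_iff g hb (smoothField_timeDeriv hJ hu ht) (hu.slice ht)]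
    refine forall_congr' fun x => ?_
    rw [(hasDerivAt_divg g hJ hu ht x).deriv, hsTerm, pow_two (divg g (u t) x), add_assoc]

end MainResults

end HunterSaxton

end

theorem mainTheorem2 {n : ℕ} {M : Type*} [TopologicalSpace M] [ChartedSpace (Model n) M]
    [IsManifold (𝓡 n) ∞ M] [CompactSpace M] [T2Space M] [ConnectedSpace M]
    [MeasurableSpace M] [BorelSpace M] (g : RMetric n M) (b : ℝ) (hb : 0 < b) :
    BiInvariant g 0 b 0 ∧
    (∀ u : Π x : M, TangentSpace (𝓡 n) x, SmoothField u →
      ((∀ v, SmoothField v → abc g 0 b 0 u v = 0) ↔ ∀ x, divg g u x = 0)) ∧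
    (∃ G : (M → ℝ) → (M → ℝ) → (M → ℝ) → ℝ, DescendsTo g 0 b 0 G) ∧
    (∀ (J : Set ℝ) (u : ℝ → Π x : M, TangentSpace (𝓡 n) x), IsOpen J → SmoothTimeField J u →
      (SolvesEulerArnold g 0 b 0 J u ↔ SolvesDifferentiated g J u) ∧
      (SolvesEulerArnold g 0 b 0 J u ↔ SolvesHunterSaxton g J u)) :=
  ⟨biInvariant_divergence_metric g b, fun _ hu => degenerate_iff_divg_eq_zero g hb hu,
    ⟨densMetric g b, descendsTo_densMetric g hb⟩, fun _ _ hJ hu => eulerArnold_iff g hb hJ hu⟩
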